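/- There are universal constants $c>0$ and $k\in\mathbb N$ such that the following holds. Let $L\ge 1$ and let $w_0=d,w_1,\dots,w_{L-1},w_L=\mathcal C$ be arbitrary layer widths. A linear network is a map $F:\mathbb R^d\to\mathbb R^{\mathcal C}$, $x\mapsto Ax=B_LB_{L-1}\cdots B_1x$ with $B_\ell\in\mathbb R^{w_\ell\times w_{\ell-1}}$. Let $\mathcal Y$ be a measurable space and let $\mathfrak l:\mathbb R^{\mathcal C}\times\mathcal Y\to[0,\mathfrak E]$ be a measurable loss function which is $\lambda$-Lipschitz in its first argument with respect to the $L^\infty$ norm. Let $(x_1,y_1),\dots,(x_N,y_N)$, $N\ge1$, be i.i.d. from a probability distribution $\mathcal D$ on $\mathbb R^d\times\mathcal Y$, let $\mathfrak B=\max_{i\le N}\|x_i\|_2$, and let $$\mathrm{GAP}(A)=\mathbb E_{(x,y)\sim\mathcal D}\,\mathfrak l(Ax,y)-\frac1N\sum_{i=1}^N\mathfrak l(Ax_i,y_i).$$ Fix $0\le p_\ell\le 1$ for $\ell=1,\dots,L$, and let $p$ be given by $\frac1p=\sum_{\ell=1}^L\frac1{p_\ell}$ (so $p=0$ if some $p_\ell=0$).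 Write $\|Z\|_{\mathrm{sc},q}^q=\sum_i\sigma_i(Z)^q$, the sum being over the nonzero singular values of $Z$ (so it is $\operatorname{rank}Z$ for $q=0$). Let $\|A\|$ be the spectral norm of $A$, and put $$\mathcal S(B)=\sum_{\ell=1}^L\frac{p\,\|B_\ell\|_{\mathrm{sc},p_\ell}^{p_\ell}}{p_\ell}\ \text{ if all } p_\ell>0,\qquad \mathcal S(B)=\min_{\ell:\,p_\ell=0}\operatorname{rank}(B_\ell)\ \text{ otherwise.}$$ Let $\delta\in(0,1)$. With probability at least $1-\delta$ over the draw of the training set, all linear networks of these widths satisfy simultaneously $$\mathrm{GAP}(A)\le c\,\mathfrak E\sqrt{\frac{\log(4/\delta)}{N}}+c\,(\mathfrak E+1)\,\log^k\!\big(2+N+\mathcal C+d+\lambda+\mathfrak B+\|A\|\big)\,\sqrt{\frac{[\lambda\mathfrak B]^{\frac{2p}{2+p}}\,\mathcal S(B)^{\frac{2}{2+p}}\,[\mathcal C+d]}{N}}.$$ Here $0^0=1$. -/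

import Mathlib

open MeasureTheory

noncomputable section

namespace LinNet

/-- The `p`-th power `‖Z‖_{sc,p}^p = ∑ σ_i(Z)^p` of the Schatten `p` quasi-norm, the sum being over
the nonzero singular values of `Z`. For `p = 0` this is the number of nonzero singular values, that
is, the rank of `Z`. -/
def schattenPow {m n : ℕ} (p : ℝ) (Z : Matrix (Fin m) (Fin n) ℝ) : ℝ :=
  ∑ i ∈ (Matrix.toEuclideanLin Z).singularValues.support,
    ((Matrix.toEuclideanLin Z).singularValues i) ^ p

/-- The spectral norm of a matrix: its operator norm between Euclidean spaces. -/
def specNorm {m n : ℕ} (Z : Matrix (Fin m) (Fin n) ℝ) : ℝ :=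
  ‖(Matrix.toEuclideanLin Z).toContinuousLinearMap‖

/-- The factors `B_1, …, B_L` of a linear network with layer widths `w 0, …, w L`. The matrix with
index `ℓ : Fin L` maps layer `ℓ` to layer `ℓ + 1`. -/
abbrev Factors (L : ℕ) (w : ℕ → ℕ) : Type :=
  (ℓ : Fin L) → Matrix (Fin (w (ℓ + 1))) (Fin (w ℓ)) ℝ

/-- The product of the first `m` factors, the later factors standing on the left. -/
def partialProd {L : ℕ} {w : ℕ → ℕ} (B : Factors L w) :
    (m : ℕ) → m ≤ L → Matrix (Fin (w m)) (Fin (w 0)) ℝ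
  | 0, _ => 1
  | m + 1, h => B ⟨m, h⟩ * partialProd B m (Nat.le_of_succ_le h)

/-- The matrix `A = B_L ⋯ B_1` of the linear network `x ↦ B_L ⋯ B_1 x`. -/
def netMatrix {L : ℕ} {w : ℕ → ℕ} (B : Factors L w) : Matrix (Fin (w L)) (Fin (w 0)) ℝ :=
  partialProd B L le_rfl

open Classical in
/-- The conjugate index `p` with `1/p = ∑ 1/p_ℓ`; it is `0` as soon as some `p_ℓ` is `0`. -/
def conjIndex {L : ℕ} (q : Fin L → ℝ) : ℝ :=
  if ∀ ℓ, 0 < q ℓ then (∑ ℓ, 1 / q ℓ)⁻¹ else 0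

open Classical in
/-- The sum `∑ p ‖B_ℓ‖_{sc,p_ℓ}^{p_ℓ} / p_ℓ`. If some indices `p_ℓ` vanish, so that `p = 0`, the
coefficients `p / p_ℓ` are limits of convex weights which concentrate on the layers with
`p_ℓ = 0`, in proportions that depend on the limit; the value is then the smallest one that a limit
can give, the least rank among those layers. -/
def factorSum {L : ℕ} {w : ℕ → ℕ} (q : Fin L → ℝ) (B : Factors L w) : ℝ :=
  if ∀ ℓ, 0 < q ℓ then ∑ ℓ, conjIndex q * schattenPow (q ℓ) (B ℓ) / q ℓ
  else ⨅ ℓ : {ℓ : Fin L // q ℓ = 0}, schattenPow 0 (B ℓ)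

/-- The loss of the linear classifier `x ↦ A x` at the labelled input `z = (x, y)`. -/
def lossAt {C d : ℕ} {Y : Type*} (l : (Fin C → ℝ) → Y → ℝ) (A : Matrix (Fin C) (Fin d) ℝ)
    (z : EuclideanSpace ℝ (Fin d) × Y) : ℝ :=
  l (A.mulVec (WithLp.ofLp z.1)) z.2

/-- The generalization gap of `x ↦ A x` on the sample `S`: expected loss minus average loss. -/
def gap {C d N : ℕ} {Y : Type*} [MeasurableSpace Y] (D : Measure (EuclideanSpace ℝ (Fin d) × Y))
    (l : (Fin C → ℝ) → Y → ℝ) (A : Matrix (Fin C) (Fin d) ℝ)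
    (S : Fin N → EuclideanSpace ℝ (Fin d) × Y) : ℝ :=
  (∫ z, lossAt l A z ∂D) - (1 / (N : ℝ)) * ∑ i, lossAt l A (S i)

/-- The largest Euclidean norm `𝔅` of an input in the sample. -/
def maxInput {d N : ℕ} {Y : Type*} (S : Fin N → EuclideanSpace ℝ (Fin d) × Y) : ℝ :=
  ⨆ i, ‖(S i).1‖

end LinNet

end

/-! Write x = λ𝔅, S = 𝒮(B) and G = x^(2p/(2+p)) S^(2/(2+p)), and number singular values from 0. A
form of Horn's inequality bounds σ_k(A)^(k+1) by the product of the top k+1 singular values of all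
factors. The weighted AM-GM inequality turns this into (k+1) σ_k(A)^p ≤ S
(`succ_mul_singularValues_rpow_le_factorSum`); for p = 0, rank A ≤ S takes its place. G is the value
that balances this decay: x σ_r ≤ √G at r = ⌈G⌉. Hence A is a product through dimension r plus a
remainder of Frobenius norm at most √d σ_r, of order √(rd)/x.

Both summands have small covers in the sup norm of the outputs on a sample (`exists_cells`).
Rounding the entries of the low-rank part costs entropy r(𝒞+d) up to logarithms. A perceptron
argument covers the remainder with entropy (Frobenius norm · 𝔅/ε)² times a logarithm, so the
dimension enters only logarithmically. Chaining over dyadic scales (`card_chaining_le`) and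
symmetrization (`measure_exists_deviation_le`) then give a deviation of order √(r(𝒞+d)/N) over one
class, up to logarithms and the confidence term.

A union bound over r and over dyadic scales of the input norm and of ‖A‖ lets the class depend on
the data. It costs logarithms and a term r log 2, absorbed by r(𝒞+d). The expectation also sees
inputs longer than 𝔅, but their mass is at most log(4/δ)/N with high probability
(`measure_tail_beyond_max_le`). The loss is centred at that of the zero map, so that it is at most
λb‖A‖ on inputs of norm at most b. This makes the bound shrink with t = x‖A‖ when t ≤ 1, as it must,
since G can then be small. `IsGoodSample.gap_netMatrix_le` joins the regimes of t. -/

namespace LinNet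

open Module

set_option linter.unusedSectionVars false

/-! ### Min-max properties of singular values. -/

section SingularValues

variable {E F : Type*} [NormedAddCommGroup E] [InnerProductSpace ℝ E] [FiniteDimensional ℝ E]
  [NormedAddCommGroup F] [InnerProductSpace ℝ F] [FiniteDimensional ℝ F]

/-- An orthonormal basis of right singular vectors. -/
theorem exists_rightSingularBasis (T : E →ₗ[ℝ] F) :
    ∃ v : OrthonormalBasis (Fin (finrank ℝ E)) ℝ E,
      ∀ x, ‖T x‖ ^ 2 = ∑ i : Fin (finrank ℝ E), T.singularValues i ^ 2 * (inner ℝ (v i) x) ^ 2 := by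
  refine ⟨T.isSymmetric_adjoint_comp_self.eigenvectorBasis rfl, fun x => ?_⟩
  set v := T.isSymmetric_adjoint_comp_self.eigenvectorBasis rfl
  have h1 : ‖T x‖ ^ 2 = inner ℝ x ((T.adjoint ∘ₗ T) x) := by
    rw [LinearMap.comp_apply, LinearMap.adjoint_inner_right, real_inner_self_eq_norm_sq]
  rw [h1, ← v.sum_inner_mul_inner x]
  refine Finset.sum_congr rfl fun i _ => ?_
  have h2 := T.isSymmetric_adjoint_comp_self.eigenvectorBasis_apply_self_apply rfl x i
  rw [OrthonormalBasis.repr_apply_apply, OrthonormalBasis.repr_apply_apply] at h2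
  rw [h2, T.sq_singularValues_fin rfl, real_inner_comm]
  simp only [RCLike.ofReal_real_eq_id, id]
  ring

theorem inner_eq_zero_of_mem_span (v : OrthonormalBasis (Fin (finrank ℝ E)) ℝ E)
    (s : Set (Fin (finrank ℝ E))) {x : E} (hx : x ∈ Submodule.span ℝ (v '' s))
    {j : Fin (finrank ℝ E)} (hj : j ∉ s) : inner ℝ (v j) x = 0 := by
  induction hx using Submodule.span_induction with
  | mem y hy =>
    obtain ⟨i, hi, rfl⟩ := hy
    exact v.orthonormal.2 (fun h => hj (h ▸ hi))
  | zero => simp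
  | add y z _ _ hy hz => rw [inner_add_right, hy, hz, add_zero]
  | smul c y _ hy => rw [inner_smul_right, hy, mul_zero]

theorem finrank_span_orthonormalBasis (v : OrthonormalBasis (Fin (finrank ℝ E)) ℝ E)
    (s : Finset (Fin (finrank ℝ E))) :
    finrank ℝ (Submodule.span ℝ (v '' (s : Set (Fin (finrank ℝ E))))) = s.card := by
  classical
  have h := v.orthonormal.linearIndependent
  rw [← Finset.coe_image, finrank_span_finset_eq_card, Finset.card_image_of_injective _ h.injective]
  rw [Finset.coe_image]
  exact (h.linearIndepOn s).id_image

/-- A subspace of dimension `i + 1` on which `T` expands by at least its `i`-th singular value. -/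
theorem exists_submodule_singularValues_le (T : E →ₗ[ℝ] F) {i : ℕ} (hi : i < finrank ℝ E) :
    ∃ U : Submodule ℝ E, finrank ℝ U = i + 1 ∧ ∀ x ∈ U, T.singularValues i * ‖x‖ ≤ ‖T x‖ := by
  obtain ⟨v, hv⟩ := exists_rightSingularBasis T
  refine ⟨Submodule.span ℝ (v '' ((Finset.Iic (⟨i, hi⟩ : Fin _) : Finset _) : Set _)), ?_, ?_⟩
  · rw [finrank_span_orthonormalBasis]; simp
  · intro x hx
    refine abs_le_of_sq_le_sq' ?_ (norm_nonneg _) |>.2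
    rw [hv, mul_pow, ← v.sum_sq_norm_inner_right x, Finset.mul_sum]
    refine Finset.sum_le_sum fun j _ => ?_
    rw [Real.norm_eq_abs, sq_abs]
    by_cases hj : (j : ℕ) ≤ i
    · gcongr
      · exact T.singularValues_nonneg i
      · exact T.singularValues_antitone hj
    · rw [inner_eq_zero_of_mem_span v _ hx (by simpa [Fin.le_def] using hj)]; simp

/-- A subspace of codimension `i` on which `T` expands by at most its `i`-th singular value. -/
theorem exists_submodule_le_singularValues (T : E →ₗ[ℝ] F) {i : ℕ} (hi : i < finrank ℝ E) :
    ∃ U : Submodule ℝ E, finrank ℝ U + i = finrank ℝ E ∧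
      ∀ x ∈ U, ‖T x‖ ≤ T.singularValues i * ‖x‖ := by
  obtain ⟨v, hv⟩ := exists_rightSingularBasis T
  refine ⟨Submodule.span ℝ (v '' ((Finset.Ici (⟨i, hi⟩ : Fin _) : Finset _) : Set _)), ?_, ?_⟩
  · rw [finrank_span_orthonormalBasis, Fin.card_Ici]; simp; omega
  · intro x hx
    refine (abs_le_of_sq_le_sq' ?_ (mul_nonneg (T.singularValues_nonneg i) (norm_nonneg _))).2
    rw [hv, mul_pow, ← v.sum_sq_norm_inner_right x, Finset.mul_sum]
    refine Finset.sum_le_sum fun j _ => ?_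
    rw [Real.norm_eq_abs, sq_abs]
    by_cases hj : i ≤ (j : ℕ)
    · gcongr
      · exact T.singularValues_nonneg j
      · exact T.singularValues_antitone hj
    · rw [inner_eq_zero_of_mem_span v _ hx (by simpa [Fin.le_def] using hj)]; simp

/-- Singular values do not increase under restriction to a subspace. -/
theorem singularValues_domRestrict_le (T : E →ₗ[ℝ] F) (W : Submodule ℝ E) (i : ℕ) :
    (T.domRestrict W).singularValues i ≤ T.singularValues i := by
  by_cases hi : i < finrank ℝ W
  swap
  · rw [LinearMap.singularValues_of_finrank_le _ (not_lt.mp hi)]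
    exact T.singularValues_nonneg i
  obtain ⟨U, hU, hU'⟩ := exists_submodule_singularValues_le (T.domRestrict W) hi
  obtain ⟨U₂, hU₂, hU₂'⟩ := exists_submodule_le_singularValues T
    (hi.trans_le (Submodule.finrank_le W))
  have hmap : finrank ℝ (U.map W.subtype) = i + 1 := by
    rw [← hU]; exact Submodule.finrank_map_subtype_eq W U
  -- The dimensions i + 1 and dim E - i add up to more than dim E, so the two subspaces share a
  -- nonzero vector, and it compares the two singular values.
  have hne : U.map W.subtype ⊓ U₂ ≠ ⊥ := by
    intro h
    have := Submodule.finrank_add_le_finrank_add_finrank (K := ℝ) (U.map W.subtype) U₂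
    have h2 := Submodule.finrank_sup_add_finrank_inf_eq (U.map W.subtype) U₂
    have h3 := Submodule.finrank_le (U.map W.subtype ⊔ U₂)
    rw [h, finrank_bot] at h2
    omega
  obtain ⟨x, hx, hx0⟩ := Submodule.exists_mem_ne_zero_of_ne_bot hne
  obtain ⟨⟨y, hyU, rfl⟩, hx₂⟩ := hx
  have h1 := hU' y hyU
  have h2 := hU₂' _ hx₂
  have hpos : 0 < ‖(W.subtype y)‖ := norm_pos_iff.mpr hx0
  have h3 : (T.domRestrict W).singularValues i * ‖W.subtype y‖
      ≤ T.singularValues i * ‖W.subtype y‖ := h1.trans h2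
  exact le_of_mul_le_mul_right h3 hpos

/-- The subspace on which `T` expands by at most its `i`-th singular value is nonzero when `i` is
below the dimension. The restriction on `i` is essential, since later singular values are 0 by
convention. -/
theorem singularValues_ge_of_forall_le (T : E →ₗ[ℝ] F) {c : ℝ} (h : ∀ x, c * ‖x‖ ≤ ‖T x‖)
    {i : ℕ} (hi : i < finrank ℝ E) : c ≤ T.singularValues i := by
  obtain ⟨U, hU, hU'⟩ := exists_submodule_le_singularValues T hi
  have hne : U ≠ ⊥ := by
    rintro rfl
    rw [finrank_bot] at hU; omega
  obtain ⟨x, hx, hx0⟩ := Submodule.exists_mem_ne_zero_of_ne_bot hne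
  exact le_of_mul_le_mul_right ((h x).trans (hU' x hx)) (norm_pos_iff.mpr hx0)

theorem singularValues_zero_le_norm (T : E →ₗ[ℝ] F) {c : ℝ} (hc : 0 ≤ c)
    (h : ∀ x, ‖T x‖ ≤ c * ‖x‖) (i : ℕ) : T.singularValues i ≤ c := by
  by_cases hi : i < finrank ℝ E
  · obtain ⟨U, hU, hU'⟩ := exists_submodule_singularValues_le T hi
    have hne : U ≠ ⊥ := by
      rintro rfl
      rw [finrank_bot] at hU; omega
    obtain ⟨x, hx, hx0⟩ := Submodule.exists_mem_ne_zero_of_ne_bot hne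
    exact le_of_mul_le_mul_right ((hU' x hx).trans (h x)) (norm_pos_iff.mpr hx0)
  · rw [LinearMap.singularValues_of_finrank_le _ (not_lt.mp hi)]; exact hc

theorem norm_le_singularValues_zero (T : E →ₗ[ℝ] F) (x : E) :
    ‖T x‖ ≤ T.singularValues 0 * ‖x‖ := by
  by_cases hi : 0 < finrank ℝ E
  · obtain ⟨U, hU, hU'⟩ := exists_submodule_le_singularValues T hi
    have : U = ⊤ := Submodule.eq_top_of_finrank_eq (by simpa using hU)
    exact hU' x (this ▸ Submodule.mem_top)
  · have : Subsingleton E := (finrank_zero_iff (R := ℝ)).mp (by omega)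
    rw [Subsingleton.elim x 0]; simp

end SingularValues

end LinNet

/-! ### Singular values of a product of matrices, and low-rank splitting. -/

namespace LinNet

open Module

/-- `normDet` is the factor by which volumes are scaled. It is multiplicative along compositions if
the outer map is restricted to the range of the inner one, and restriction does not increase
singular values. -/
theorem normDet_partialProd_le {L : ℕ} {w : ℕ → ℕ} (B : Factors L w)
    (V : Submodule ℝ (EuclideanSpace ℝ (Fin (w 0)))) :
    ∀ (m : ℕ) (h : m ≤ L), ((Matrix.toEuclideanLin (partialProd B m h)).domRestrict V).normDet ≤
      ∏ ℓ : Fin m, ∏ i ∈ Finset.range (finrank ℝ V),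
        (Matrix.toEuclideanLin (B ⟨ℓ, ℓ.2.trans_le h⟩)).singularValues i
  | 0, h => by
    have : (Matrix.toEuclideanLin (partialProd B 0 h)).domRestrict V = V.subtype := by
      ext x; simp [partialProd]
    rw [this]
    simp
  | m + 1, h => by
    have ih := normDet_partialProd_le B V m (Nat.le_of_succ_le h)
    set f := (Matrix.toEuclideanLin (partialProd B m (Nat.le_of_succ_le h))).domRestrict V with hf
    set g := Matrix.toEuclideanLin (B ⟨m, h⟩) with hg
    have hcomp : (Matrix.toEuclideanLin (partialProd B (m + 1) h)).domRestrict V = g ∘ₗ f := by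
      ext x; simp [partialProd, hf, hg]
    rw [hcomp, LinearMap.normDet_comp, Fin.prod_univ_castSucc, mul_comm]
    have hnn : 0 ≤ ∏ ℓ : Fin m, ∏ i ∈ Finset.range (finrank ℝ V),
        (Matrix.toEuclideanLin (B ⟨ℓ, ℓ.2.trans_le (Nat.le_of_succ_le h)⟩)).singularValues i :=
      Finset.prod_nonneg fun _ _ => Finset.prod_nonneg fun _ _ => LinearMap.singularValues_nonneg _ _
    have hnn' : 0 ≤ ∏ i ∈ Finset.range (finrank ℝ V), g.singularValues i :=
      Finset.prod_nonneg fun _ _ => LinearMap.singularValues_nonneg _ _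
    -- If the volume does not collapse, the range of `f` has the dimension of `V`, so the next
    -- factor contributes exactly its top `finrank V` singular values.
    by_cases h0 : f.normDet = 0
    · rw [h0, zero_mul]; exact mul_nonneg hnn hnn'
    have hrank : finrank ℝ f.range = finrank ℝ V := by
      by_contra hne
      exact h0 (LinearMap.normDet_eq_zero_iff_rank_range_ne.mpr hne)
    refine mul_le_mul ih ?_ (LinearMap.normDet_nonneg _) hnn
    rw [LinearMap.normDet_eq_prod_singularValues, hrank]
    exact Finset.prod_le_prod (fun _ _ => LinearMap.singularValues_nonneg _ _)
      fun i _ => singularValues_domRestrict_le g _ i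

/-- A consequence of Horn's inequality for products of matrices. -/
theorem singularValues_netMatrix_pow_le {L : ℕ} {w : ℕ → ℕ} (B : Factors L w) (k : ℕ) :
    (Matrix.toEuclideanLin (netMatrix B)).singularValues k ^ (k + 1) ≤
      ∏ ℓ : Fin L, ∏ i ∈ Finset.range (k + 1),
        (Matrix.toEuclideanLin (B ℓ)).singularValues i := by
  set T := Matrix.toEuclideanLin (netMatrix B) with hT
  by_cases hk : k < finrank ℝ (EuclideanSpace ℝ (Fin (w 0)))
  swap
  · rw [LinearMap.singularValues_of_finrank_le _ (not_lt.mp hk), zero_pow (by omega)]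
    exact Finset.prod_nonneg fun _ _ =>
      Finset.prod_nonneg fun _ _ => LinearMap.singularValues_nonneg _ _
  obtain ⟨V, hV, hV'⟩ := exists_submodule_singularValues_le T hk
  have h1 := normDet_partialProd_le B V L le_rfl
  rw [hV] at h1
  -- On `V` all k + 1 singular values of the product matrix are at least its `k`-th one, so its
  -- volume factor on `V` is at least the (k + 1)-st power of that value.
  refine le_trans ?_ h1
  rw [LinearMap.normDet_eq_prod_singularValues, hV, ← Finset.card_range (k + 1),
    ← Finset.prod_const, Finset.card_range]
  refine Finset.prod_le_prod (fun _ _ => T.singularValues_nonneg _) fun i hi => ?_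
  refine singularValues_ge_of_forall_le _ (fun x : V => hV' (x : EuclideanSpace ℝ (Fin (w 0))) x.property) ?_
  rw [hV]; exact Finset.mem_range.mp hi

/-- The set `s` may leave the support of the singular values. This is harmless for p > 0 because 0^p
= 0, and would fail for p = 0. -/
theorem sum_singularValues_rpow_le_schattenPow {m n : ℕ} {p : ℝ} (hp : 0 < p)
    (Z : Matrix (Fin m) (Fin n) ℝ) (s : Finset ℕ) :
    ∑ i ∈ s, (Matrix.toEuclideanLin Z).singularValues i ^ p ≤ schattenPow p Z := by
  unfold schattenPow
  have h0 : ∀ i, 0 ≤ (Matrix.toEuclideanLin Z).singularValues i ^ p :=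
    fun i => Real.rpow_nonneg (LinearMap.singularValues_nonneg _ _) _
  rw [Finset.sum_subset (s₂ := s ∪ (Matrix.toEuclideanLin Z).singularValues.support)
    (s₁ := (Matrix.toEuclideanLin Z).singularValues.support)
    Finset.subset_union_right fun i _ hi => by
      rw [Finsupp.notMem_support_iff.mp hi, Real.zero_rpow hp.ne']]
  exact Finset.sum_le_sum_of_subset_of_nonneg Finset.subset_union_left fun i _ _ => h0 i

theorem schattenPow_nonneg {m n : ℕ} (p : ℝ) (Z : Matrix (Fin m) (Fin n) ℝ) :
    0 ≤ schattenPow p Z :=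
  Finset.sum_nonneg fun _ _ => Real.rpow_nonneg (LinearMap.singularValues_nonneg _ _) _

theorem schattenPow_zero {m n : ℕ} (Z : Matrix (Fin m) (Fin n) ℝ) :
    schattenPow 0 Z = finrank ℝ (Matrix.toEuclideanLin Z).range := by
  simp [schattenPow]

theorem conjIndex_pos {L : ℕ} (hL : 0 < L) {q : Fin L → ℝ} (hq : ∀ ℓ, 0 < q ℓ) :
    0 < conjIndex q := by
  rw [conjIndex, if_pos hq]
  have : Nonempty (Fin L) := ⟨⟨0, hL⟩⟩
  exact inv_pos.mpr (Finset.sum_pos (fun ℓ _ => one_div_pos.mpr (hq ℓ)) Finset.univ_nonempty)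

theorem conjIndex_nonneg {L : ℕ} (hL : 0 < L) (q : Fin L → ℝ) : 0 ≤ conjIndex q := by
  by_cases hq : ∀ ℓ, 0 < q ℓ
  · exact (conjIndex_pos hL hq).le
  · rw [conjIndex, if_neg hq]

theorem conjIndex_le_one {L : ℕ} (hL : 0 < L) {q : Fin L → ℝ} (hq : ∀ ℓ, q ℓ ≤ 1) :
    conjIndex q ≤ 1 := by
  by_cases h : ∀ ℓ, 0 < q ℓ
  · rw [conjIndex, if_pos h]
    refine inv_le_one_of_one_le₀ ?_
    refine le_trans ?_ (Finset.single_le_sum (f := fun ℓ => 1 / q ℓ)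
      (fun ℓ _ => (one_div_pos.mpr (h ℓ)).le) (Finset.mem_univ ⟨0, hL⟩))
    rw [le_div_iff₀ (h _), one_mul]; exact hq _
  · rw [conjIndex, if_neg h]; exact zero_le_one

/-- AM-GM is applied to the numbers σ_i(B_ℓ)^(q_ℓ), i ≤ k, with weights p/(q_ℓ (k+1)). These sum to
1 by the definition of p, and cancel the exponents q_ℓ, so the geometric mean is the product in
Horn's inequality to the power p/(k+1). -/
theorem succ_mul_singularValues_rpow_le_factorSum {L : ℕ} (hL : 0 < L) {w : ℕ → ℕ}
    {q : Fin L → ℝ} (hq : ∀ ℓ, 0 < q ℓ) (B : Factors L w) (k : ℕ) :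
    ((k : ℝ) + 1) * (Matrix.toEuclideanLin (netMatrix B)).singularValues k ^ conjIndex q ≤
      factorSum q B := by
  set p := conjIndex q with hp
  have hp0 : 0 < p := conjIndex_pos hL hq
  have hpsum : ∑ ℓ, p / q ℓ = 1 := by
    have : p⁻¹ = ∑ ℓ, 1 / q ℓ := by rw [hp, conjIndex, if_pos hq, inv_inv]
    simp_rw [div_eq_mul_one_div p, ← Finset.mul_sum, ← this]
    exact mul_inv_cancel₀ hp0.ne'
  set K : ℝ := (k : ℝ) + 1 with hK
  have hK0 : 0 < K := by positivity
  set s : Fin L → ℕ → ℝ := fun ℓ i => (Matrix.toEuclideanLin (B ℓ)).singularValues i with hs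
  have hs0 : ∀ ℓ i, 0 ≤ s ℓ i := fun ℓ i => LinearMap.singularValues_nonneg _ _
  have hσ0 := LinearMap.singularValues_nonneg (Matrix.toEuclideanLin (netMatrix B)) k
  set σ := (Matrix.toEuclideanLin (netMatrix B)).singularValues k with hσ
  have hmain := singularValues_netMatrix_pow_le B k
  have hag := Real.geom_mean_le_arith_mean_weighted
    (Finset.univ ×ˢ Finset.range (k + 1) : Finset (Fin L × ℕ))
    (fun x => p / q x.1 / K) (fun x => s x.1 x.2 ^ q x.1)
    (fun x _ => by have := hq x.1; positivity)
    (by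
      rw [Finset.sum_product]
      simp only [Finset.sum_const, Finset.card_range, nsmul_eq_mul]
      push_cast
      rw [← hK]
      refine Eq.trans (Finset.sum_congr rfl fun ℓ _ => ?_) hpsum
      field_simp)
    (fun x _ => Real.rpow_nonneg (hs0 _ _) _)
  have hl : ∏ x ∈ (Finset.univ ×ˢ Finset.range (k + 1) : Finset (Fin L × ℕ)),
      (s x.1 x.2 ^ q x.1) ^ (p / q x.1 / K) =
      (∏ ℓ : Fin L, ∏ i ∈ Finset.range (k + 1), s ℓ i) ^ (p / K) := by
    rw [← Finset.prod_product', ← Real.finsetProd_rpow _ _ fun x _ => hs0 _ _]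
    refine Finset.prod_congr rfl fun x _ => ?_
    rw [← Real.rpow_mul (hs0 _ _)]
    congr 1
    have := (hq x.1).ne'
    field_simp
  rw [hl] at hag
  have h1 : σ ^ p ≤ (∏ ℓ : Fin L, ∏ i ∈ Finset.range (k + 1), s ℓ i) ^ (p / K) := by
    have h2 := Real.rpow_le_rpow (pow_nonneg hσ0 _) hmain (z := p / K) (by positivity)
    refine le_trans (le_of_eq ?_) h2
    rw [← Real.rpow_natCast, ← Real.rpow_mul hσ0]
    congr 1
    push_cast; rw [← hK]; field_simp
  have h3 := h1.trans hag
  rw [Finset.sum_product] at h3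
  calc K * σ ^ p ≤ K * ∑ ℓ, ∑ i ∈ Finset.range (k + 1), p / q ℓ / K * s ℓ i ^ q ℓ := by gcongr
    _ = ∑ ℓ, p / q ℓ * ∑ i ∈ Finset.range (k + 1), s ℓ i ^ q ℓ := by
      rw [Finset.mul_sum]
      refine Finset.sum_congr rfl fun ℓ _ => ?_
      rw [Finset.mul_sum, Finset.mul_sum]
      refine Finset.sum_congr rfl fun i _ => ?_
      field_simp
    _ ≤ ∑ ℓ, p / q ℓ * schattenPow (q ℓ) (B ℓ) := by
      refine Finset.sum_le_sum fun ℓ _ => ?_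
      have := hq ℓ
      gcongr
      exact sum_singularValues_rpow_le_schattenPow (hq ℓ) _ _
    _ = factorSum q B := by
      rw [factorSum, if_pos hq]
      refine Finset.sum_congr rfl fun ℓ _ => ?_
      ring

theorem finrank_range_partialProd_le {L : ℕ} {w : ℕ → ℕ} (B : Factors L w) :
    ∀ (m : ℕ) (h : m ≤ L) (ℓ : Fin L), (ℓ : ℕ) < m →
      finrank ℝ (Matrix.toEuclideanLin (partialProd B m h)).range ≤
        finrank ℝ (Matrix.toEuclideanLin (B ℓ)).range
  | 0, _, ℓ, hℓ => absurd hℓ (Nat.not_lt_zero _)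
  | m + 1, h, ℓ, hℓ => by
    have hcomp : Matrix.toEuclideanLin (partialProd B (m + 1) h) =
        Matrix.toEuclideanLin (B ⟨m, h⟩) ∘ₗ
          Matrix.toEuclideanLin (partialProd B m (Nat.le_of_succ_le h)) := by
      ext x; simp [partialProd]
    rw [hcomp]
    rcases Nat.lt_succ_iff_lt_or_eq.mp hℓ with hlt | heq
    · refine le_trans ?_ (finrank_range_partialProd_le B m (Nat.le_of_succ_le h) ℓ hlt)
      rw [LinearMap.range_comp]
      exact Submodule.finrank_map_le _ _
    · obtain rfl : ℓ = ⟨m, h⟩ := Fin.ext heq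
      exact Submodule.finrank_mono (LinearMap.range_comp_le_range _ _)

theorem finrank_range_netMatrix_le_factorSum {L : ℕ} {w : ℕ → ℕ} {q : Fin L → ℝ}
    (hq0 : ∀ ℓ, 0 ≤ q ℓ) (hq : ¬ ∀ ℓ, 0 < q ℓ) (B : Factors L w) :
    (finrank ℝ (Matrix.toEuclideanLin (netMatrix B)).range : ℝ) ≤ factorSum q B := by
  rw [factorSum, if_neg hq]
  push Not at hq
  obtain ⟨ℓ, hℓ⟩ := hq
  have : Nonempty {ℓ : Fin L // q ℓ = 0} := ⟨⟨ℓ, le_antisymm hℓ (hq0 ℓ)⟩⟩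
  refine le_ciInf fun j => ?_
  rw [schattenPow_zero]
  exact_mod_cast finrank_range_partialProd_le B L le_rfl j.1 j.1.2

theorem factorSum_nonneg {L : ℕ} (hL : 0 < L) {w : ℕ → ℕ} (q : Fin L → ℝ)
    (B : Factors L w) : 0 ≤ factorSum q B := by
  unfold factorSum
  split_ifs with h
  · exact Finset.sum_nonneg fun ℓ _ => div_nonneg (mul_nonneg (conjIndex_nonneg hL q)
      (schattenPow_nonneg _ _)) (h ℓ).le
  · exact Real.iInf_nonneg fun _ => schattenPow_nonneg _ _

theorem specNorm_nonneg {m n : ℕ} (Z : Matrix (Fin m) (Fin n) ℝ) : 0 ≤ specNorm Z :=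
  norm_nonneg _

theorem norm_toEuclideanLin_le {m n : ℕ} (Z : Matrix (Fin m) (Fin n) ℝ)
    (x : EuclideanSpace ℝ (Fin n)) : ‖Matrix.toEuclideanLin Z x‖ ≤ specNorm Z * ‖x‖ :=
  (Matrix.toEuclideanLin Z).toContinuousLinearMap.le_opNorm x

theorem specNorm_eq_singularValues_zero {m n : ℕ} (Z : Matrix (Fin m) (Fin n) ℝ) :
    specNorm Z = (Matrix.toEuclideanLin Z).singularValues 0 := by
  refine le_antisymm ?_ ?_
  · exact ContinuousLinearMap.opNorm_le_bound _ (LinearMap.singularValues_nonneg _ _)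
      fun x => norm_le_singularValues_zero _ x
  · exact singularValues_zero_le_norm _ (specNorm_nonneg Z) (norm_toEuclideanLin_le Z) 0

theorem norm_mulVec_le {m n : ℕ} (Z : Matrix (Fin m) (Fin n) ℝ)
    (x : EuclideanSpace ℝ (Fin n)) : ‖Z.mulVec (WithLp.ofLp x)‖ ≤ specNorm Z * ‖x‖ := by
  refine le_trans ?_ (norm_toEuclideanLin_le Z x)
  refine (pi_norm_le_iff_of_nonneg (norm_nonneg _)).mpr fun i => ?_
  exact PiLp.norm_apply_le (Matrix.toEuclideanLin Z x) i

/-- Splitting off the part of a matrix that belongs to its `r` largest singular values. -/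
theorem exists_lowRank_add {C d : ℕ} (A : Matrix (Fin C) (Fin d) ℝ) {r : ℕ} (hr : r ≤ d) :
    ∃ (U : Matrix (Fin C) (Fin r) ℝ) (V : Matrix (Fin r) (Fin d) ℝ),
      (∀ c k, |U c k| ≤ specNorm A) ∧ (∀ k i, |V k i| ≤ 1) ∧
      ∑ c, ∑ i, ((A - U * V) c i) ^ 2 ≤
        d * (Matrix.toEuclideanLin A).singularValues r ^ 2 := by
  set T := Matrix.toEuclideanLin A with hT
  obtain ⟨v, hv⟩ := exists_rightSingularBasis T
  have hd : finrank ℝ (EuclideanSpace ℝ (Fin d)) = d := finrank_euclideanSpace_fin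
  let e : Fin r → Fin (finrank ℝ (EuclideanSpace ℝ (Fin d))) :=
    fun k => ⟨k, by rw [hd]; exact k.2.trans_le hr⟩
  have hv1 : ∀ k, ‖v k‖ = 1 := fun k => v.orthonormal.1 k
  -- The rows of `V` are the first `r` right singular vectors, the columns of `U` their images; this
  -- gives the entry bounds.
  refine ⟨fun c k => (T (v (e k))) c, fun k i => (v (e k)) i, ?_, ?_, ?_⟩
  · intro c k
    refine (PiLp.norm_apply_le (T (v (e k))) c).trans ?_
    simpa [hv1] using norm_toEuclideanLin_le A (v (e k))
  · intro k i
    simpa [hv1] using PiLp.norm_apply_le (v (e k)) i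
  -- The coordinates of the rows of A - UV in the basis `v`. Summing their squares over rows gives ∑
  -- ‖T v_k‖² = ∑ σ_k² over k ≥ r, at most d σ_r².
  set c' : Fin C → Fin (finrank ℝ (EuclideanSpace ℝ (Fin d))) → ℝ :=
    fun c k => if r ≤ (k : ℕ) then (T (v k)) c else 0 with hc'
  have hent : ∀ c i, (A - (Matrix.of fun c k => (T (v (e k))) c : Matrix (Fin C) (Fin r) ℝ) *
      (Matrix.of fun k i => (v (e k)) i : Matrix (Fin r) (Fin d) ℝ)) c i =
      (∑ k, c' c k • v k) i := by
    intro c i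
    have h1 : A c i = ∑ k, (T (v k)) c * (v k) i := by
      have h2 : A c i = (T (EuclideanSpace.single i 1)) c := by
        simp [hT, Matrix.toLpLin_apply]
      rw [h2]
      conv_lhs => rw [← v.sum_repr' (EuclideanSpace.single i (1 : ℝ))]
      rw [map_sum]
      simp [EuclideanSpace.inner_single_right, mul_comm]
    have h3 : ∑ k : Fin r, (T (v (e k))) c * (v (e k)) i =
        ∑ k : Fin (finrank ℝ (EuclideanSpace ℝ (Fin d))),
          (if r ≤ (k : ℕ) then 0 else (T (v k)) c * (v k) i) := by
      refine Finset.sum_of_injOn e ?_ (fun _ _ => Finset.mem_coe.mpr (Finset.mem_univ _)) ?_ ?_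
      · intro a _ b _ hab
        simpa [e, Fin.ext_iff] using hab
      · intro k _ hk
        rw [if_pos]
        by_contra hlt
        exact hk ⟨⟨k, not_le.mp hlt⟩, by simp, rfl⟩
      · intro k _
        rw [if_neg]
        exact not_le.mpr k.2
    rw [Matrix.sub_apply, Matrix.mul_apply, h1]
    simp only [Matrix.of_apply]
    rw [h3, ← Finset.sum_sub_distrib]
    simp only [hc', PiLp.smul_apply, smul_eq_mul, WithLp.ofLp_sum, Finset.sum_apply]
    refine Finset.sum_congr rfl fun k _ => ?_
    split_ifs <;> simp
  have hrow : ∀ c, ∑ i, ((∑ k, c' c k • v k) i) ^ 2 = ∑ k, c' c k ^ 2 := by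
    intro c
    have h1 := EuclideanSpace.real_norm_sq_eq (∑ k, c' c k • v k)
    rw [← h1, ← v.sum_sq_norm_inner_right]
    refine Finset.sum_congr rfl fun k _ => ?_
    rw [v.orthonormal.inner_right_fintype, Real.norm_eq_abs, sq_abs]
  calc _ = ∑ c, ∑ k, c' c k ^ 2 := by
        refine Finset.sum_congr rfl fun c _ => ?_
        rw [← hrow]
        exact Finset.sum_congr rfl fun i _ => by rw [← hent]; rfl
    _ = ∑ k, ∑ c, c' c k ^ 2 := Finset.sum_comm
    _ ≤ ∑ k : Fin (finrank ℝ (EuclideanSpace ℝ (Fin d))), T.singularValues r ^ 2 := by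
        refine Finset.sum_le_sum fun k _ => ?_
        by_cases hk : r ≤ (k : ℕ)
        · simp only [hc', hk, if_true]
          rw [← EuclideanSpace.real_norm_sq_eq, hv, Finset.sum_eq_single k]
          · rw [real_inner_self_eq_norm_sq, hv1]
            simp only [one_pow, mul_one]
            exact pow_le_pow_left₀ (T.singularValues_nonneg _) (T.singularValues_antitone hk) 2
          · intro j _ hj
            rw [v.orthonormal.2 hj]; simp
          · simp
        · simp only [hc', hk, if_false]
          simp; positivity
    _ = d * T.singularValues r ^ 2 := by simp

end LinNet

/-! ### Hoeffding's inequality and chaining for random signs. -/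

namespace LinNet

/-- The sign `±1` encoded by a Boolean. -/
def sgn (s : Bool) : ℝ := if s then 1 else -1

theorem sum_exp_signed_sum {N : ℕ} (u : Fin N → ℝ) :
    ∑ σ : Fin N → Bool, Real.exp (∑ i, sgn (σ i) * u i) = ∏ i, (2 * Real.cosh (u i)) := by
  have h : ∀ i, 2 * Real.cosh (u i) = ∑ s : Bool, Real.exp (sgn s * u i) := by
    intro i
    rw [Real.cosh_eq]; simp [sgn]; ring
  simp_rw [h, Finset.prod_univ_sum, Fintype.piFinset_univ, Real.exp_sum]

/-- Hoeffding's inequality for signed sums. -/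
theorem card_signed_sum_gt_le {N : ℕ} (u : Fin N → ℝ) {M : ℝ} (hM : ∀ i, |u i| ≤ M)
    {δ : ℝ} (hδ : 0 < δ) :
    ((Finset.univ.filter fun σ : Fin N → Bool =>
      M * Real.sqrt (2 * N * Real.log (1 / δ)) < ∑ i, sgn (σ i) * u i).card : ℝ) ≤ δ * 2 ^ N := by
  by_cases hδ1 : 1 ≤ δ
  · have h1 := Finset.card_filter_le (Finset.univ : Finset (Fin N → Bool))
      (fun σ => M * Real.sqrt (2 * N * Real.log (1 / δ)) < ∑ i, sgn (σ i) * u i)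
    have h2 : (Finset.univ : Finset (Fin N → Bool)).card = 2 ^ N := by simp
    rw [h2] at h1
    calc _ ≤ ((2 ^ N : ℕ) : ℝ) := by exact_mod_cast h1
      _ = 1 * 2 ^ N := by push_cast; ring
      _ ≤ _ := by gcongr
  push Not at hδ1
  rcases Nat.eq_zero_or_pos N with rfl | hN
  · simp; exact hδ.le
  have hM0 : 0 ≤ M := (abs_nonneg _).trans (hM ⟨0, hN⟩)
  rcases hM0.eq_or_lt with rfl | hMpos
  · have hu : ∀ i, u i = 0 := fun i => abs_nonpos_iff.mp (hM i)
    simp [hu]; exact hδ.le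
  set ℓ := Real.log (1 / δ) with hℓ
  have hℓ0 : 0 < ℓ := Real.log_pos (by rw [lt_div_iff₀ hδ]; linarith)
  have hNr : (0 : ℝ) < N := by exact_mod_cast hN
  set s := Real.sqrt (2 * N * ℓ) with hs
  have hs2 : s ^ 2 = 2 * N * ℓ := Real.sq_sqrt (by positivity)
  -- The Chernoff parameter: N (tM)²/2 = ℓ while the threshold contributes tMs = 2ℓ, which leaves
  -- exp(-ℓ) = δ.
  set t := s / (N * M) with ht
  have ht0 : 0 ≤ t := by positivity
  have key : ∑ σ : Fin N → Bool, Real.exp (∑ i, sgn (σ i) * (t * u i)) ≤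
      2 ^ N * Real.exp ℓ := by
    rw [sum_exp_signed_sum, Finset.prod_mul_distrib, Finset.prod_const, Finset.card_univ,
      Fintype.card_fin]
    gcongr
    calc ∏ i, Real.cosh (t * u i) ≤ ∏ i : Fin N, Real.exp ((t * M) ^ 2 / 2) := by
          refine Finset.prod_le_prod (fun i _ => (Real.cosh_pos _).le) fun i _ => ?_
          refine (Real.cosh_le_exp_half_sq _).trans ?_
          rw [mul_pow, mul_pow, ← sq_abs (u i)]
          have := hM i
          gcongr
      _ = Real.exp ℓ := by
          rw [Finset.prod_const, Finset.card_univ, Fintype.card_fin, ← Real.exp_nat_mul]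
          congr 1
          rw [ht]
          field_simp
          rw [hs2]; ring
  have hthr : t * (M * s) = 2 * ℓ := by
    rw [ht]; field_simp; rw [hs2]; ring
  have hmark : ((Finset.univ.filter fun σ : Fin N → Bool =>
      M * s < ∑ i, sgn (σ i) * u i).card : ℝ) * Real.exp (2 * ℓ) ≤ 2 ^ N * Real.exp ℓ := by
    refine le_trans ?_ (le_trans (Finset.sum_le_sum_of_subset_of_nonneg
      (Finset.filter_subset (fun σ : Fin N → Bool => M * s < ∑ i, sgn (σ i) * u i) Finset.univ)
      fun _ _ _ => (Real.exp_pos _).le) key)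
    rw [← nsmul_eq_mul]
    refine Finset.card_nsmul_le_sum _ _ _ fun σ hσ => ?_
    rw [Finset.mem_filter] at hσ
    refine Real.exp_le_exp.mpr ?_
    have : ∑ i, sgn (σ i) * (t * u i) = t * ∑ i, sgn (σ i) * u i := by
      rw [Finset.mul_sum]; exact Finset.sum_congr rfl fun i _ => by ring
    rw [this, ← hthr]
    exact mul_le_mul_of_nonneg_left hσ.2.le ht0
  have hexp : Real.exp (-ℓ) = δ := by
    rw [hℓ, one_div, Real.log_inv, neg_neg, Real.exp_log hδ]
  have h2 : Real.exp (2 * ℓ) = Real.exp ℓ * Real.exp ℓ := by rw [← Real.exp_add]; congr 1; ring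
  have hne := (Real.exp_pos ℓ)
  rw [h2, ← mul_assoc] at hmark
  have h3 := le_of_mul_le_mul_right hmark hne
  rw [← hexp, Real.exp_neg, inv_mul_eq_div, le_div_iff₀ hne]
  exact h3

theorem card_filter_exists_le {Ω K : Type*} [Fintype Ω] [Fintype K] (p : K → Ω → Prop)
    [∀ k, DecidablePred (p k)] [DecidablePred fun ω => ∃ k, p k ω] {c : ℝ}
    (h : ∀ k, ((Finset.univ.filter (p k)).card : ℝ) ≤ c) :
    ((Finset.univ.filter fun ω => ∃ k, p k ω).card : ℝ) ≤ Fintype.card K * c := by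
  classical
  have : (Finset.univ.filter fun ω => ∃ k, p k ω) =
      Finset.univ.biUnion fun k => Finset.univ.filter (p k) := by
    ext; simp
  rw [this]
  calc _ ≤ ((∑ k, (Finset.univ.filter (p k)).card : ℕ) : ℝ) := by
        exact_mod_cast Finset.card_biUnion_le
    _ ≤ ∑ k : K, c := by push_cast; exact Finset.sum_le_sum fun k _ => h k
    _ = _ := by simp

open Classical in
/-- Chaining for signed sums: at level `j` the index set is divided into cells, the elements of a
cell being `η j`-close in the sup norm. -/
theorem card_chaining_le {𝒜 : Type*} [Nonempty 𝒜] {N : ℕ} (v : 𝒜 → Fin N → ℝ) {e : ℝ}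
    (he : ∀ a i, |v a i| ≤ e) (J : ℕ) (K : ℕ → Type) [∀ j, Fintype (K j)]
    (κ : ∀ j, 𝒜 → K j) (η : ℕ → ℝ)
    (hκ : ∀ j ≤ J, ∀ a a', κ j a = κ j a' → ∀ i, |v a i - v a' i| ≤ η j) {δ : ℝ} (hδ : 0 < δ) :
    ((Finset.univ.filter fun σ : Fin N → Bool => ∃ a,
      e * Real.sqrt (2 * N * Real.log (Fintype.card (K 0) / δ)) +
        ∑ j ∈ Finset.range J, (η j + η (j + 1)) * Real.sqrt (2 * N *
          Real.log (Fintype.card (K j) * Fintype.card (K (j + 1)) / δ)) + N * η J <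
      ∑ i, sgn (σ i) * v a i).card : ℝ) ≤ (J + 1) * δ * 2 ^ N := by
  let rep : ∀ j, K j → 𝒜 := fun j => Function.invFun (κ j)
  have hrep : ∀ j a, κ j (rep j (κ j a)) = κ j a := fun j a => Function.invFun_eq ⟨a, rfl⟩
  have hKpos : ∀ j, (0 : ℝ) < Fintype.card (K j) := fun j => by
    have : Nonempty (K j) := ⟨κ j (Classical.arbitrary 𝒜)⟩
    exact_mod_cast Fintype.card_pos
  let bad0 : K 0 → (Fin N → Bool) → Prop := fun k σ =>
    e * Real.sqrt (2 * N * Real.log (Fintype.card (K 0) / δ)) < ∑ i, sgn (σ i) * v (rep 0 k) i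
  let u : ∀ j, K j × K (j + 1) → Fin N → ℝ := fun j k i => v (rep (j + 1) k.2) i - v (rep j k.1) i
  -- The union bound runs over all pairs of cells, also those without a common element, whose
  -- representatives may be far apart. The closeness clause makes the event empty for pairs that are
  -- not close.
  let badj : ∀ j, K j × K (j + 1) → (Fin N → Bool) → Prop := fun j k σ =>
    (∀ i, |u j k i| ≤ η j + η (j + 1)) ∧ (η j + η (j + 1)) * Real.sqrt (2 * N *
      Real.log (Fintype.card (K j) * Fintype.card (K (j + 1)) / δ)) < ∑ i, sgn (σ i) * u j k i
  have hcancel : ∀ x : ℝ, x ≠ 0 → x * (δ / x * 2 ^ N) = δ * 2 ^ N := fun x hx => by field_simp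
  have h0 : ((Finset.univ.filter fun σ => ∃ k, bad0 k σ).card : ℝ) ≤ δ * 2 ^ N := by
    refine (card_filter_exists_le bad0 (c := δ / Fintype.card (K 0) * 2 ^ N) fun k => ?_).trans ?_
    · have := card_signed_sum_gt_le (v (rep 0 k)) (he _) (div_pos hδ (hKpos 0))
      rwa [one_div_div] at this
    · exact (hcancel _ (hKpos 0).ne').le
  have hj : ∀ j, ((Finset.univ.filter fun σ => ∃ k, badj j k σ).card : ℝ) ≤ δ * 2 ^ N := by
    intro j
    have hp := mul_pos (hKpos j) (hKpos (j + 1))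
    refine (card_filter_exists_le (badj j)
      (c := δ / (Fintype.card (K j) * Fintype.card (K (j + 1))) * 2 ^ N) fun k => ?_).trans ?_
    · by_cases hu : ∀ i, |u j k i| ≤ η j + η (j + 1)
      · have := card_signed_sum_gt_le (u j k) hu (div_pos hδ hp)
        rw [one_div_div] at this
        simpa only [badj, hu, implies_true, true_and] using this
      · simp only [badj, hu, false_and, Finset.filter_false, Finset.card_empty, Nat.cast_zero]
        positivity
    · rw [Fintype.card_prod]; push_cast
      exact (hcancel _ hp.ne').le
  have hsub : (Finset.univ.filter fun σ : Fin N → Bool => ∃ a,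
      e * Real.sqrt (2 * N * Real.log (Fintype.card (K 0) / δ)) +
        ∑ j ∈ Finset.range J, (η j + η (j + 1)) * Real.sqrt (2 * N *
          Real.log (Fintype.card (K j) * Fintype.card (K (j + 1)) / δ)) + N * η J <
      ∑ i, sgn (σ i) * v a i) ⊆ (Finset.univ.filter fun σ => ∃ k, bad0 k σ) ∪
        (Finset.range J).biUnion fun j => Finset.univ.filter fun σ => ∃ k, badj j k σ := by
    intro σ hσ
    rw [Finset.mem_filter] at hσ
    obtain ⟨-, a, ha⟩ := hσ
    by_contra hgood
    simp only [Finset.mem_union, Finset.mem_filter, Finset.mem_univ, true_and, Finset.mem_biUnion,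
      not_or, not_exists, not_and] at hgood
    obtain ⟨g0, gj⟩ := hgood
    let X : 𝒜 → ℝ := fun a => ∑ i, sgn (σ i) * v a i
    have h1 : X (rep 0 (κ 0 a)) ≤ e * Real.sqrt (2 * N * Real.log (Fintype.card (K 0) / δ)) :=
      not_lt.mp (g0 _)
    have hclose : ∀ j ≤ J, ∀ i, |v (rep j (κ j a)) i - v a i| ≤ η j :=
      fun j hjJ => hκ j hjJ _ _ (hrep j a)
    have h2 : ∀ j ∈ Finset.range J, X (rep (j + 1) (κ (j + 1) a)) - X (rep j (κ j a)) ≤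
        (η j + η (j + 1)) * Real.sqrt (2 * N *
          Real.log (Fintype.card (K j) * Fintype.card (K (j + 1)) / δ)) := by
      intro j hjJ
      have hu : ∀ i, |u j (κ j a, κ (j + 1) a) i| ≤ η j + η (j + 1) := by
        intro i
        have e1 := abs_le.mp (hclose j (Finset.mem_range.mp hjJ).le i)
        have e2 := abs_le.mp (hclose (j + 1) (Finset.mem_range.mp hjJ) i)
        simp only [u, abs_le]
        constructor <;> linarith [e1.1, e1.2, e2.1, e2.2]
      have h3 := gj j hjJ (κ j a, κ (j + 1) a)
      simp only [badj, not_and, not_lt] at h3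
      refine le_trans (le_of_eq ?_) (h3 hu)
      simp only [X, u, mul_sub, Finset.sum_sub_distrib]
    -- The last link needs no probability: each of the N terms changes by at most η J.
    have h3 : X a - X (rep J (κ J a)) ≤ N * η J := by
      have : ∀ i ∈ Finset.univ, sgn (σ i) * v a i - sgn (σ i) * v (rep J (κ J a)) i ≤ η J := by
        intro i _
        have e1 := abs_le.mp (hclose J le_rfl i)
        cases σ i <;> simp [sgn] <;> linarith [e1.1, e1.2]
      have h4 := Finset.sum_le_sum this
      simpa [X, Finset.sum_sub_distrib] using h4
    have h5 := Finset.sum_le_sum h2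
    rw [Finset.sum_range_sub fun j => X (rep j (κ j a))] at h5
    have h6 : X a = ∑ i, sgn (σ i) * v a i := rfl
    linarith
  calc _ ≤ ((((Finset.univ.filter fun σ => ∃ k, bad0 k σ).card +
        ∑ j ∈ Finset.range J, (Finset.univ.filter fun σ => ∃ k, badj j k σ).card : ℕ)) : ℝ) := by
        exact_mod_cast (Finset.card_le_card hsub).trans ((Finset.card_union_le _ _).trans
          (Nat.add_le_add_left Finset.card_biUnion_le _))
    _ ≤ δ * 2 ^ N + ∑ j ∈ Finset.range J, δ * 2 ^ N := by
        push_cast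
        exact add_le_add h0 (Finset.sum_le_sum fun j _ => hj j)
    _ = _ := by simp; ring

end LinNet

/-! ### Covering numbers: perceptron updates and rounding. -/

namespace LinNet

section Perceptron

variable {H ι : Type*} [NormedAddCommGroup H] [InnerProductSpace ℝ H]

/-- The vector assembled by a sequence of signed updates of step size `s` along the vectors `v`. -/
noncomputable def updateSum (v : ι → H) (s : ℝ) {K : ℕ} (f : Fin K → Option (ι × Bool)) : H :=
  ∑ k, (f k).elim 0 fun u => (if u.2 then s else -s) • v u.1

/-- While some |⟨y, v_i⟩| exceeds ε, a signed step ε/b² along v_i lowers ‖y‖² by at least ε²/b², so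
at most R²b²/ε² steps occur. The list of steps is a code for `x` over an alphabet of 2|ι| + 1
letters (`none` is an idle step), whatever the dimension of `H`. -/
theorem exists_updateSum_close (v : ι → H) {b ε R : ℝ} (hb : 0 < b) (hv : ∀ i, ‖v i‖ ≤ b)
    (hε : 0 < ε) {x : H} (hx : ‖x‖ ≤ R) {K : ℕ} (hK : R ^ 2 * b ^ 2 ≤ K * ε ^ 2) :
    ∃ f : Fin K → Option (ι × Bool), ∀ i, |inner ℝ (x - updateSum v (ε / b ^ 2) f) (v i)| ≤ ε := by
  have key : ∀ n : ℕ, ∃ f : Fin n → Option (ι × Bool),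
      (∀ i, |inner ℝ (x - updateSum v (ε / b ^ 2) f) (v i)| ≤ ε) ∨
        ‖x - updateSum v (ε / b ^ 2) f‖ ^ 2 ≤ R ^ 2 - n * (ε ^ 2 / b ^ 2) := by
    intro n
    induction n with
    | zero =>
      refine ⟨Fin.elim0, Or.inr ?_⟩
      simp only [updateSum, Finset.univ_eq_empty, Finset.sum_empty, sub_zero, Nat.cast_zero,
        zero_mul]
      gcongr
    | succ n ih =>
      obtain ⟨f, hf⟩ := ih
      by_cases hgood : ∀ i, |inner ℝ (x - updateSum v (ε / b ^ 2) f) (v i)| ≤ ε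
      · refine ⟨Fin.snoc f none, Or.inl ?_⟩
        have : updateSum v (ε / b ^ 2) (Fin.snoc f none : Fin (n + 1) → _) =
            updateSum v (ε / b ^ 2) f := by
          simp [updateSum, Fin.sum_univ_castSucc]
        rwa [this]
      · have hf2 := hf.resolve_left hgood
        push Not at hgood
        obtain ⟨i, hi⟩ := hgood
        set y := x - updateSum v (ε / b ^ 2) f with hy
        refine ⟨Fin.snoc f (some (i, decide (0 ≤ inner ℝ y (v i)))), Or.inr ?_⟩
        set c : ℝ := if 0 ≤ inner ℝ y (v i) then ε / b ^ 2 else -(ε / b ^ 2) with hc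
        have hu : x - updateSum v (ε / b ^ 2) (Fin.snoc f (some (i, decide (0 ≤ inner ℝ y (v i)))) :
            Fin (n + 1) → _) = y - c • v i := by
          have : updateSum v (ε / b ^ 2) (Fin.snoc f (some (i, decide (0 ≤ inner ℝ y (v i)))) :
              Fin (n + 1) → _) = updateSum v (ε / b ^ 2) f + c • v i := by
            rw [hc]
            simp [updateSum, Fin.sum_univ_castSucc]
          rw [this, hy, sub_sub]
        have hcin : ε / b ^ 2 * ε ≤ c * inner ℝ y (v i) := by
          have hstep : 0 < ε / b ^ 2 := by positivity
          rw [hc]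
          split_ifs with h
          · rw [abs_of_nonneg h] at hi
            gcongr
          · rw [abs_of_neg (not_le.mp h)] at hi
            rw [neg_mul, ← mul_neg]
            gcongr
        have hcsq : c ^ 2 = (ε / b ^ 2) ^ 2 := by rw [hc]; split_ifs <;> ring
        have hvi : ‖v i‖ ^ 2 ≤ b ^ 2 := by have := hv i; gcongr
        rw [hu, norm_sub_sq_real, inner_smul_right, norm_smul, mul_pow, Real.norm_eq_abs, sq_abs,
          hcsq]
        have h1 : (ε / b ^ 2) ^ 2 * ‖v i‖ ^ 2 ≤ (ε / b ^ 2) ^ 2 * b ^ 2 := by gcongr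
        have h2 : (ε / b ^ 2) ^ 2 * b ^ 2 = ε ^ 2 / b ^ 2 := by field_simp
        have h3 : ε / b ^ 2 * ε = ε ^ 2 / b ^ 2 := by ring
        push_cast
        linarith
  obtain ⟨f, hf⟩ := key K
  refine ⟨f, hf.elim id fun h => ?_⟩
  have h1 : R ^ 2 ≤ K * (ε ^ 2 / b ^ 2) := by
    rw [← mul_div_assoc, le_div_iff₀ (by positivity)]; exact hK
  -- If no step was idle, the energy is used up after `K` steps and the residual vanishes.
  have h2 : ‖x - updateSum v (ε / b ^ 2) f‖ = 0 := by
    have : ‖x - updateSum v (ε / b ^ 2) f‖ ^ 2 ≤ 0 := by linarith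
    exact pow_eq_zero_iff two_ne_zero |>.mp (le_antisymm this (sq_nonneg _))
  intro i
  rw [norm_eq_zero.mp h2]
  simpa using hε.le

end Perceptron

/-- The matrices that are the sum of a product through dimension `r`, with bounded entries, and a
matrix of Frobenius norm at most `R`. -/
def lowRankAdd (C d r : ℕ) (a R : ℝ) : Set (Matrix (Fin C) (Fin d) ℝ) :=
  {A | ∃ (U : Matrix (Fin C) (Fin r) ℝ) (V : Matrix (Fin r) (Fin d) ℝ),
    (∀ c k, |U c k| ≤ a) ∧ (∀ k i, |V k i| ≤ 1) ∧ ∑ c, ∑ i, ((A - U * V) c i) ^ 2 ≤ R ^ 2}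

/-- The cell of width `1 / n` that contains a number of `[-1, 1]`. -/
noncomputable def roundCode (n : ℕ) (u : ℝ) : Fin (2 * n + 1) :=
  Fin.ofNat (2 * n + 1) (⌊n * u⌋ + n).toNat

theorem abs_sub_le_of_roundCode_eq {n : ℕ} (hn : 0 < n) {u u' : ℝ} (hu : |u| ≤ 1)
    (hu' : |u'| ≤ 1) (h : roundCode n u = roundCode n u') : |u - u'| ≤ 1 / n := by
  have hn' : (0 : ℝ) < n := by exact_mod_cast hn
  -- The shifted floor lies in [0, 2n], so neither `toNat` nor the reduction modulo 2n + 1 loses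
  -- anything.
  have hbd : ∀ x : ℝ, |x| ≤ 1 → 0 ≤ ⌊n * x⌋ + (n : ℤ) ∧ (⌊n * x⌋ + (n : ℤ)).toNat < 2 * n + 1 := by
    intro x hx
    obtain ⟨h1, h2⟩ := abs_le.mp hx
    have h3 : -(n : ℤ) ≤ ⌊n * x⌋ := Int.le_floor.mpr (by push_cast; nlinarith)
    have h4 : ⌊n * x⌋ ≤ (n : ℤ) := by
      have : (⌊n * x⌋ : ℝ) ≤ n := (Int.floor_le _).trans (by nlinarith)
      exact_mod_cast this
    omega
  have e1 := hbd u hu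
  have e2 := hbd u' hu'
  have h' := congrArg Fin.val h
  simp only [roundCode, Fin.ofNat, Nat.mod_eq_of_lt e1.2, Nat.mod_eq_of_lt e2.2] at h'
  have hfl : ⌊n * u⌋ = ⌊n * u'⌋ := by omega
  have := Int.abs_sub_lt_one_of_floor_eq_floor hfl
  rw [← mul_sub, abs_mul, abs_of_pos hn'] at this
  rw [le_div_iff₀ hn', mul_comm]
  exact this.le

theorem abs_mulVec_mul_sub_le {C d r : ℕ} {U U' : Matrix (Fin C) (Fin r) ℝ}
    {V V' : Matrix (Fin r) (Fin d) ℝ} {a s b : ℝ} (ha : 0 ≤ a) (hs : 0 ≤ s)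
    (hU' : ∀ c k, |U' c k| ≤ a) (hV : ∀ k i, |V k i| ≤ 1)
    (hUU : ∀ c k, |U c k - U' c k| ≤ a * s) (hVV : ∀ k i, |V k i - V' k i| ≤ s)
    {x : Fin d → ℝ} (hx : ∀ i, |x i| ≤ b) (c : Fin C) :
    |((U * V - U' * V').mulVec x) c| ≤ 2 * r * d * a * s * b := by
  have h1 : ∀ i, |(U * V - U' * V') c i| ≤ r * (2 * (a * s)) := by
    intro i
    rw [Matrix.sub_apply, Matrix.mul_apply, Matrix.mul_apply, ← Finset.sum_sub_distrib]
    refine (Finset.abs_sum_le_sum_abs _ _).trans ?_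
    refine (Finset.sum_le_card_nsmul _ _ (2 * (a * s)) fun k _ => ?_).trans (by simp)
    have : U c k * V k i - U' c k * V' k i =
        (U c k - U' c k) * V k i + U' c k * (V k i - V' k i) := by ring
    rw [this]
    refine (abs_add_le _ _).trans ?_
    rw [abs_mul, abs_mul]
    have e1 : |U c k - U' c k| * |V k i| ≤ (a * s) * 1 :=
      mul_le_mul (hUU c k) (hV k i) (abs_nonneg _) (by positivity)
    have e2 : |U' c k| * |V k i - V' k i| ≤ a * s :=
      mul_le_mul (hU' c k) (hVV k i) (abs_nonneg _) ha
    linarith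
  rw [Matrix.mulVec, dotProduct]
  refine (Finset.abs_sum_le_sum_abs _ _).trans ?_
  refine (Finset.sum_le_card_nsmul _ _ (r * (2 * (a * s)) * b) fun i _ => ?_).trans ?_
  · rw [abs_mul]
    exact mul_le_mul (h1 i) (hx i) (abs_nonneg _) (by positivity)
  · simp only [Finset.card_univ, Fintype.card_fin, nsmul_eq_mul]
    apply le_of_eq; ring

/-- A partition of `lowRankAdd` into few cells, in each of which the outputs at finitely many given
points are close to each other. -/
theorem exists_cells {C d r : ℕ} {a R b ε : ℝ} (ha : 0 < a) (hb : 0 < b) (hε : 0 < ε)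
    {n : ℕ} (hn : 0 < n) {ι : Type*} [Fintype ι] (x : ι → EuclideanSpace ℝ (Fin d))
    (hx : ∀ i, ‖x i‖ ≤ b) :
    ∃ (K : Type) (_ : Fintype K) (κ : lowRankAdd C d r a R → K),
      Real.log (Fintype.card K) ≤ r * (C + d) * Real.log (2 * n + 1) +
        (R ^ 2 * b ^ 2 / ε ^ 2 + 1) * Real.log (2 * (Fintype.card ι * C) + 1) ∧
      ∀ A A', κ A = κ A' → ∀ i,
        ‖A.1.mulVec (WithLp.ofLp (x i)) - A'.1.mulVec (WithLp.ofLp (x i))‖ ≤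
          2 * r * d * a * b / n + 2 * ε := by
  have hn' : (0 : ℝ) < n := by exact_mod_cast hn
  choose U V hU hV hR using fun A : lowRankAdd C d r a R => A.2
  set M := ⌈R ^ 2 * b ^ 2 / ε ^ 2⌉₊ with hM
  -- One test vector per pair of a point and an output coordinate: its inner product with a matrix
  -- is that coordinate of the matrix applied to the point.
  let v : Fin (Fintype.card ι) × Fin C → EuclideanSpace ℝ (Fin C × Fin d) := fun p =>
    WithLp.toLp 2 fun q => if q.1 = p.2 then (x ((Fintype.equivFin ι).symm p.1)) q.2 else 0
  have hv : ∀ p, ‖v p‖ ≤ b := by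
    intro p
    refine le_trans (le_of_eq ?_) (hx ((Fintype.equivFin ι).symm p.1))
    rw [EuclideanSpace.norm_eq, EuclideanSpace.norm_eq]
    congr 1
    rw [Fintype.sum_prod_type, Finset.sum_eq_single p.2]
    · simp [v]
    · intro c _ hc; simp [v, hc]
    · simp
  let W : lowRankAdd C d r a R → EuclideanSpace ℝ (Fin C × Fin d) := fun A =>
    WithLp.toLp 2 fun q => (A.1 - U A * V A) q.1 q.2
  have hW : ∀ A, ‖W A‖ ≤ |R| := by
    intro A
    refine abs_le_of_sq_le_sq' ?_ (abs_nonneg _) |>.2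
    rw [EuclideanSpace.real_norm_sq_eq, Fintype.sum_prod_type, sq_abs]
    exact hR A
  have hMe : |R| ^ 2 * b ^ 2 ≤ M * ε ^ 2 := by
    rw [sq_abs, ← div_le_iff₀ (by positivity)]; exact Nat.le_ceil _
  choose f hf using fun A => exists_updateSum_close v hb hv hε (hW A) hMe
  -- A cell records the rounded `U / a` and `V` and the list of updates for the remainder. Two
  -- remainders with the same list are each ε-close to the same update sum, hence the 2ε.
  refine ⟨((Fin C × Fin r → Fin (2 * n + 1)) × (Fin r × Fin d → Fin (2 * n + 1))) ×
    (Fin M → Option ((Fin (Fintype.card ι) × Fin C) × Bool)), inferInstance,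
    fun A => ((fun q => roundCode n (U A q.1 q.2 / a), fun q => roundCode n (V A q.1 q.2)), f A),
    ?_, ?_⟩
  · have hcard : Fintype.card (((Fin C × Fin r → Fin (2 * n + 1)) ×
        (Fin r × Fin d → Fin (2 * n + 1))) ×
        (Fin M → Option ((Fin (Fintype.card ι) × Fin C) × Bool))) =
        (2 * n + 1) ^ (C * r + r * d) * (2 * (Fintype.card ι * C) + 1) ^ M := by
      simp [pow_add, mul_comm]
    rw [hcard]
    push_cast
    rw [Real.log_mul (by positivity) (by positivity), Real.log_pow, Real.log_pow]
    refine add_le_add (le_of_eq ?_) ?_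
    · push_cast; ring
    · have h0 : 0 ≤ Real.log (2 * ((Fintype.card ι : ℝ) * C) + 1) :=
        Real.log_nonneg (by
          have : (0 : ℝ) ≤ (Fintype.card ι : ℝ) * C := by positivity
          linarith)
      gcongr
      exact (Nat.ceil_lt_add_one (by positivity)).le
  · intro A A' hAA i
    simp only [Prod.mk.injEq] at hAA
    obtain ⟨⟨h1, h2⟩, h3⟩ := hAA
    have hdiv : ∀ A c k, |U A c k / a| ≤ 1 := fun A c k => by
      rw [abs_div, abs_of_pos ha, div_le_one ha]; exact hU A c k
    have hUU : ∀ c k, |U A c k - U A' c k| ≤ a * (1 / n) := by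
      intro c k
      have := abs_sub_le_of_roundCode_eq hn (hdiv A c k) (hdiv A' c k) (congrFun h1 (c, k))
      rw [← sub_div, abs_div, abs_of_pos ha, div_le_iff₀ ha] at this
      linarith
    have hVV : ∀ k j, |V A k j - V A' k j| ≤ 1 / n := fun k j =>
      abs_sub_le_of_roundCode_eq hn (hV A k j) (hV A' k j) (congrFun h2 (k, j))
    have hxi : ∀ j, |(x i) j| ≤ b := fun j => (PiLp.norm_apply_le (x i) j).trans (hx i)
    refine (pi_norm_le_iff_of_nonneg (by positivity)).mpr fun c => ?_
    have hin : ∀ B : lowRankAdd C d r a R, inner ℝ (W B) (v (Fintype.equivFin ι i, c)) =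
        ((B.1 - U B * V B).mulVec (WithLp.ofLp (x i))) c := by
      intro B
      rw [PiLp.inner_apply, Fintype.sum_prod_type, Finset.sum_eq_single c]
      · simp [v, W, Matrix.mulVec, dotProduct, mul_comm]
      · intro c' _ hc'; simp [v, hc']
      · simp
    have e1 := hf A (Fintype.equivFin ι i, c)
    have e2 := hf A' (Fintype.equivFin ι i, c)
    rw [h3] at e1
    rw [inner_sub_left, hin] at e1 e2
    have e3 := abs_mulVec_mul_sub_le (U := U A) (U' := U A') (V := V A) (V' := V A') ha.le
      (by positivity) (hU A') (hV A) hUU hVV hxi c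
    have hsplit : (A.1.mulVec (WithLp.ofLp (x i)) - A'.1.mulVec (WithLp.ofLp (x i))) c =
        ((U A * V A - U A' * V A').mulVec (WithLp.ofLp (x i))) c +
        ((A.1 - U A * V A).mulVec (WithLp.ofLp (x i))) c -
        ((A'.1 - U A' * V A').mulVec (WithLp.ofLp (x i))) c := by
      simp only [Matrix.sub_mulVec, Pi.sub_apply]; ring
    rw [Real.norm_eq_abs, hsplit]
    have e4 : 2 * r * d * a * (1 / n) * b = 2 * r * d * a * b / n := by ring
    rw [e4] at e3
    rw [abs_le] at e1 e2 e3 ⊢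
    constructor <;> linarith [e1.1, e1.2, e2.1, e2.2, e3.1, e3.2]

end LinNet

/-! ### Symmetrization with a ghost sample. -/

namespace LinNet

open ProbabilityTheory

variable {Z : Type*} [MeasurableSpace Z]

/-- Hoeffding's inequality for the lower deviation of an empirical sum. -/
theorem half_le_measure_sum_gt (D : Measure Z) [IsProbabilityMeasure D] {g : Z → ℝ}
    (hg : Measurable g) {e : ℝ} (he0 : 0 < e) (he : ∀ z, |g z| ≤ e) {N : ℕ} (hN : 0 < N) :
    (2 : ENNReal)⁻¹ ≤ Measure.pi (fun _ : Fin N => D)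
      {S | N * ∫ z, g z ∂D - 2 * e * Real.sqrt N < ∑ k, g (S k)} := by
  set μ := Measure.pi (fun _ : Fin N => D) with hμ
  have hN' : (0 : ℝ) < N := by exact_mod_cast hN
  let X : Fin N → (Fin N → Z) → ℝ := fun k S => -g (S k) - ∫ z, -g z ∂D
  have hind : iIndepFun X μ :=
    iIndepFun_pi (X := fun (_ : Fin N) z => -g z - ∫ z, -g z ∂D)
      fun _ => (hg.neg.sub_const _).aemeasurable
  have hsub : ∀ k ∈ (Finset.univ : Finset (Fin N)),
      HasSubgaussianMGF (X k) ((‖e - -e‖₊ / 2) ^ 2) μ := by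
    intro k _
    have h1 : HasSubgaussianMGF (fun z => -g z - ∫ z, -g z ∂D) ((‖e - -e‖₊ / 2) ^ 2) D := by
      refine hasSubgaussianMGF_of_mem_Icc hg.neg.aemeasurable (ae_of_all _ fun z => ?_)
      have := abs_le.mp (he z)
      constructor <;> linarith [this.1, this.2]
    have h2 : μ.map (fun S => S k) = D := (measurePreserving_eval (fun _ => D) k).map_eq
    exact HasSubgaussianMGF.of_map (X := fun z => -g z - ∫ z, -g z ∂D) (Y := fun S : Fin N → Z => S k)
      (measurable_pi_apply k).aemeasurable (h2.symm ▸ h1)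
  have hH := HasSubgaussianMGF.measure_sum_ge_le_of_iIndepFun hind hsub
    (ε := 2 * e * Real.sqrt N) (by positivity)
  have hc : ((∑ k : Fin N, (‖e - -e‖₊ / 2) ^ 2 : NNReal) : ℝ) = N * e ^ 2 := by
    simp only [Finset.sum_const, Finset.card_univ, Fintype.card_fin, nsmul_eq_mul]
    push_cast
    rw [Real.norm_eq_abs, abs_of_pos (by linarith)]
    ring_nf
  -- The deviation 2e√N is chosen so that the failure probability is at most exp(-2), below 1/2.
  have hexp : -(2 * e * Real.sqrt N) ^ 2 / (2 * (N * e ^ 2)) = -2 := by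
    rw [mul_pow, Real.sq_sqrt hN'.le]; field_simp
  rw [hc, hexp] at hH
  have hms : MeasurableSet {S : Fin N → Z | 2 * e * Real.sqrt N ≤ ∑ k, X k S} := by
    refine measurableSet_le measurable_const (Finset.measurable_sum _ fun k _ => ?_)
    exact ((hg.comp (measurable_pi_apply k)).neg).sub_const _
  have hset : {S : Fin N → Z | N * ∫ z, g z ∂D - 2 * e * Real.sqrt N < ∑ k, g (S k)} =
      {S : Fin N → Z | 2 * e * Real.sqrt N ≤ ∑ k, X k S}ᶜ := by
    ext S
    simp only [Set.mem_ofPred_eq, Set.mem_compl_iff, not_le, X, integral_neg,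
      Finset.sum_sub_distrib, Finset.sum_neg_distrib, Finset.sum_const, Finset.card_univ,
      Fintype.card_fin, nsmul_eq_mul]
    constructor <;> intro h <;> linarith
  rw [hset, prob_compl_eq_one_sub hms, ← ENNReal.ofReal_one, ← ofReal_measureReal,
    ← ENNReal.ofReal_sub _ measureReal_nonneg, ← ENNReal.ofReal_ofNat, ← ENNReal.ofReal_inv_of_pos]
  · refine ENNReal.ofReal_le_ofReal ?_
    have : Real.exp (-2) ≤ 1 / 2 := by
      rw [Real.exp_neg, ← one_div]
      have h2 := Real.add_one_le_exp (2 : ℝ)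
      gcongr; linarith
    linarith
  · norm_num

/-- Exchanging a sample point with its ghost does not change the joint law, but flips the sign of
their difference; this is where the signs come from. -/
theorem measurePreserving_signed_swap (D : Measure Z) [IsProbabilityMeasure D] {N : ℕ}
    (σ : Fin N → Bool) :
    MeasurePreserving (fun (ω : Fin N → Z × Z) k => if σ k then ω k else (ω k).swap)
      (Measure.pi fun _ => D.prod D) (Measure.pi fun _ => D.prod D) := by
  refine measurePreserving_pi (f := fun k (p : Z × Z) => if σ k then p else p.swap) _ _ fun k => ?_
  cases σ k
  · simpa using Measure.measurePreserving_swap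
  · simpa using! MeasurePreserving.id _

open Classical in
/-- Symmetrization: uniform deviations from the mean are controlled by signed sums, sample by
sample. -/
theorem measure_exists_deviation_le (D : Measure Z) [IsProbabilityMeasure D] {ι : Type*}
    [Countable ι] {g : ι → Z → ℝ} (hg : ∀ i, Measurable (g i)) {e : ℝ} (he0 : 0 < e)
    (he : ∀ i z, |g i z| ≤ e) {N : ℕ} (hN : 0 < N) {u δ : ℝ}
    (h : ∀ z z' : Fin N → Z, ((Finset.univ.filter fun σ : Fin N → Bool =>
      ∃ i, N * u < ∑ k, sgn (σ k) * (g i (z' k) - g i (z k))).card : ℝ) ≤ δ * 2 ^ N) :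
    Measure.pi (fun _ : Fin N => D)
      {S | ∃ i, u + 2 * e / Real.sqrt N < ∫ z, g i z ∂D - 1 / N * ∑ k, g i (S k)} ≤
      ENNReal.ofReal (2 * δ) := by
  set μ := Measure.pi (fun _ : Fin N => D) with hμ
  have hN' : (0 : ℝ) < N := by exact_mod_cast hN
  let G : (Fin N → Bool) → Set (Fin N → Z × Z) := fun σ =>
    {ω | ∃ i, N * u < ∑ k, sgn (σ k) * (g i (ω k).2 - g i (ω k).1)}
  have hGm : ∀ σ, MeasurableSet (G σ) := by
    intro σ
    have : G σ = ⋃ i, {ω | N * u < ∑ k, sgn (σ k) * (g i (ω k).2 - g i (ω k).1)} := by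
      ext; simp [G]
    rw [this]
    refine MeasurableSet.iUnion fun i => measurableSet_lt measurable_const
      (Finset.measurable_sum _ fun k _ => ?_)
    exact (((hg i).comp (measurable_snd.comp (measurable_pi_apply k))).sub
      ((hg i).comp (measurable_fst.comp (measurable_pi_apply k)))).const_mul _
  set ν := Measure.pi (fun _ : Fin N => D.prod D) with hν
  let τ : Fin N → Bool := fun _ => true
  -- the ghost sample
  have step1 : μ {S | ∃ i, u + 2 * e / Real.sqrt N < ∫ z, g i z ∂D - 1 / N * ∑ k, g i (S k)} ≤
      2 * ν (G τ) := by
    let P : Set ((Fin N → Z) × (Fin N → Z)) :=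
      {p | ∃ i, N * u < ∑ k, (g i (p.2 k) - g i (p.1 k))}
    have hPm : MeasurableSet P := by
      have : P = ⋃ i, {p | N * u < ∑ k, (g i (p.2 k) - g i (p.1 k))} := by ext; simp [P]
      rw [this]
      refine MeasurableSet.iUnion fun i => measurableSet_lt measurable_const
        (Finset.measurable_sum _ fun k _ => ?_)
      exact ((hg i).comp ((measurable_pi_apply k).comp measurable_snd)).sub
        ((hg i).comp ((measurable_pi_apply k).comp measurable_fst))
    have hPν : (μ.prod μ) P = ν (G τ) := by
      have hmp := measurePreserving_arrowProdEquivProdArrow Z Z (Fin N) (fun _ => D) (fun _ => D)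
      rw [← hmp.measure_preimage hPm.nullMeasurableSet]
      congr 1
      ext ω
      simp [P, G, τ, sgn, MeasurableEquiv.arrowProdEquivProdArrow, Equiv.arrowProdEquivProdArrow]
    rw [← hPν, Measure.prod_apply hPm]
    -- For a bad `S` fix a deviating index. With probability at least 1/2 the ghost sum for this
    -- index is not far below its mean, so the two samples differ; Markov's inequality then gives
    -- the factor 2.
    have hsub : {S | ∃ i, u + 2 * e / Real.sqrt N < ∫ z, g i z ∂D - 1 / N * ∑ k, g i (S k)} ⊆
        {S | (2 : ENNReal)⁻¹ ≤ μ (Prod.mk S ⁻¹' P)} := by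
      rintro S ⟨i, hi⟩
      refine (half_le_measure_sum_gt D (hg i) he0 (he i) hN).trans (measure_mono fun S' hS' => ?_)
      refine ⟨i, ?_⟩
      simp only [Set.mem_ofPred_eq] at hS'
      rw [Finset.sum_sub_distrib]
      have h1 := mul_lt_mul_of_pos_left hi hN'
      have h2 : (N : ℝ) * (2 * e / Real.sqrt N) = 2 * e * Real.sqrt N := by
        have h3 := Real.mul_self_sqrt hN'.le
        have h4 := (Real.sqrt_pos.mpr hN').ne'
        field_simp
        rw [sq, h3]
      have h5 : (N : ℝ) * (1 / N * ∑ k, g i (S k)) = ∑ k, g i (S k) := by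
        field_simp
      rw [mul_add, mul_sub, h2, h5] at h1
      linarith
    refine (measure_mono hsub).trans ?_
    have := mul_meas_ge_le_lintegral (μ := μ) (measurable_measure_prodMk_left hPm (ν := μ))
      (2 : ENNReal)⁻¹
    rw [mul_comm, ← div_eq_mul_inv] at this
    rw [mul_comm]
    exact (ENNReal.div_le_iff_le_mul (Or.inl (by norm_num)) (Or.inl (by norm_num))).mp this
  have step2 : ∀ σ, ν (G σ) = ν (G τ) := by
    intro σ
    rw [← (measurePreserving_signed_swap D σ).measure_preimage (hGm τ).nullMeasurableSet]
    congr 1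
    ext ω
    simp only [G, τ, Set.mem_ofPred_eq, Set.mem_preimage]
    refine exists_congr fun i => ?_
    have : ∀ k, sgn (σ k) * (g i (ω k).2 - g i (ω k).1) = sgn true *
        (g i (if σ k then ω k else (ω k).swap).2 - g i (if σ k then ω k else (ω k).swap).1) := by
      intro k
      cases σ k <;> simp [sgn]
    simp_rw [this]
  have hδ : 0 ≤ δ := by
    have hpow : (0 : ℝ) < 2 ^ N := by positivity
    obtain ⟨z⟩ : Nonempty (Fin N → Z) := by
      have : Nonempty Z := nonempty_of_isProbabilityMeasure D
      infer_instance
    have := (Nat.cast_nonneg _).trans (h z z)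
    exact nonneg_of_mul_nonneg_left this hpow
  -- All 2^N sign patterns have equal probability, so their sum is the integral of the number of bad
  -- patterns, which `h` bounds at each pair of samples.
  have step3 : (2 : ENNReal) ^ N * ν (G τ) ≤ ENNReal.ofReal (δ * 2 ^ N) := by
    have h1 : (2 : ENNReal) ^ N * ν (G τ) = ∑ σ : Fin N → Bool, ν (G σ) := by
      simp [step2]
    have h2 : ∑ σ : Fin N → Bool, ν (G σ) =
        ∫⁻ ω, ∑ σ : Fin N → Bool, (G σ).indicator 1 ω ∂ν := by
      rw [lintegral_finsetSum _ fun σ _ => measurable_one.indicator (hGm σ)]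
      exact Finset.sum_congr rfl fun σ _ => (lintegral_indicator_one (hGm σ)).symm
    rw [h1, h2]
    calc _ ≤ ∫⁻ _, ENNReal.ofReal (δ * 2 ^ N) ∂ν := by
          refine lintegral_mono fun ω => ?_
          have h3 := h (fun k => (ω k).1) (fun k => (ω k).2)
          have h4 : ∑ σ : Fin N → Bool, (G σ).indicator (1 : (Fin N → Z × Z) → ENNReal) ω =
              ((Finset.univ.filter fun σ : Fin N → Bool =>
                ∃ i, N * u < ∑ k, sgn (σ k) * (g i (ω k).2 - g i (ω k).1)).card : ENNReal) := by
            rw [Finset.card_filter]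
            push_cast
            exact Finset.sum_congr rfl fun σ _ => by simp [Set.indicator_apply, G]
          rw [h4, ← ENNReal.ofReal_natCast]
          exact ENNReal.ofReal_le_ofReal h3
      _ = _ := by simp
  have step4 : ν (G τ) ≤ ENNReal.ofReal δ := by
    rw [ENNReal.ofReal_mul hδ, mul_comm, ENNReal.ofReal_pow (by norm_num), ENNReal.ofReal_ofNat]
      at step3
    exact (ENNReal.mul_le_mul_iff_left (by positivity) (by finiteness)).mp step3
  calc _ ≤ 2 * ν (G τ) := step1
    _ ≤ 2 * ENNReal.ofReal δ := by gcongr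
    _ = _ := by rw [ENNReal.ofReal_mul (by norm_num), ENNReal.ofReal_ofNat]

end LinNet

/-! ### Uniform deviation over one class of matrices. -/

namespace LinNet

theorem sqrt_add_le (x y : ℝ) : Real.sqrt (x + y) ≤ Real.sqrt x + Real.sqrt y := by
  rcases le_total x 0 with hx | hx
  · rw [Real.sqrt_eq_zero_of_nonpos hx, zero_add]
    exact Real.sqrt_le_sqrt (by linarith)
  rcases le_total y 0 with hy | hy
  · rw [Real.sqrt_eq_zero_of_nonpos hy, add_zero]
    exact Real.sqrt_le_sqrt (by linarith)
  rw [Real.sqrt_le_left (by positivity), add_sq, Real.sq_sqrt hx, Real.sq_sqrt hy]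
  have : 0 ≤ 2 * Real.sqrt x * Real.sqrt y := by positivity
  linarith

theorem sqrt_entropy_le {e ρ P h D : ℝ} (he : 0 < e) (hρ : 0 ≤ ρ) (hP : 0 ≤ P) (hh : 0 ≤ h)
    (m : ℕ) :
    Real.sqrt (2 * P + 2 * ((ρ ^ 2 / (e / 2 ^ m) ^ 2 + 1) * h) + D) ≤
      2 * Real.sqrt P + 2 * Real.sqrt h + Real.sqrt D + 2 * (2 ^ m * ρ / e * Real.sqrt h) := by
  have h1 : 2 * P + 2 * ((ρ ^ 2 / (e / 2 ^ m) ^ 2 + 1) * h) + D =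
      2 * P + 2 * h + D + 2 * ((2 ^ m * ρ / e) ^ 2 * h) := by
    field_simp; ring
  have h2 : ∀ x, 0 ≤ x → Real.sqrt (2 * x) ≤ 2 * Real.sqrt x := by
    intro x hx
    rw [Real.sqrt_le_left (by positivity), mul_pow, Real.sq_sqrt hx]
    linarith
  rw [h1]
  refine (sqrt_add_le _ _).trans (add_le_add ((sqrt_add_le _ _).trans (add_le_add
    ((sqrt_add_le _ _).trans (add_le_add (h2 P hP) (h2 h hh))) le_rfl)) ?_)
  refine (h2 _ (by positivity)).trans ?_
  rw [Real.sqrt_mul (by positivity), Real.sqrt_sq (by positivity)]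

/-- `P` is the entropy of rounding, `h` the logarithm of the alphabet and `D` the confidence. The
root of the entropy ρ²4^j/e² times the scale e/2^j is of order ρ at every level, whence the factor J
+ 1; the other terms sum geometrically. -/
theorem chaining_sum_le {e ρ P h D N : ℝ} (he : 0 < e) (hρ : 0 ≤ ρ) (hP : 0 ≤ P) (hh : 0 ≤ h)
    (hN : 0 ≤ N) (J : ℕ) :
    2 * e * Real.sqrt (2 * N * (P + (ρ ^ 2 / (e / 2 ^ 0) ^ 2 + 1) * h + D)) +
      ∑ j ∈ Finset.range J, (9 * e / 2 ^ j) *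
        Real.sqrt (2 * N * (2 * P + 2 * ((ρ ^ 2 / (e / 2 ^ (j + 1)) ^ 2 + 1) * h) + D)) ≤
      Real.sqrt N * (80 * e * (Real.sqrt P + Real.sqrt h + Real.sqrt D) +
        80 * (J + 1) * ρ * Real.sqrt h) := by
  have hs2 : Real.sqrt (2 * N) ≤ 2 * Real.sqrt N := by
    rw [Real.sqrt_le_left (by positivity), mul_pow, Real.sq_sqrt hN]; linarith
  set B := Real.sqrt P + Real.sqrt h + Real.sqrt D with hB
  have hB0 : 0 ≤ B := by positivity
  set q := Real.sqrt h with hq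
  have hq0 : 0 ≤ q := Real.sqrt_nonneg _
  have hterm : ∀ m : ℕ, ∀ x, x ≤ 2 * P + 2 * ((ρ ^ 2 / (e / 2 ^ m) ^ 2 + 1) * h) + D →
      Real.sqrt (2 * N * x) ≤ 2 * Real.sqrt N * (2 * B + 2 * (2 ^ m * ρ / e * q)) := by
    intro m x hx
    rw [Real.sqrt_mul (by positivity)]
    refine mul_le_mul hs2 ?_ (Real.sqrt_nonneg _) (by positivity)
    refine (Real.sqrt_le_sqrt hx).trans ((sqrt_entropy_le he hρ hP hh m).trans ?_)
    have := Real.sqrt_nonneg D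
    rw [hB]; linarith
  have h0 : 2 * e * Real.sqrt (2 * N * (P + (ρ ^ 2 / (e / 2 ^ 0) ^ 2 + 1) * h + D)) ≤
      Real.sqrt N * (8 * e * B + 8 * ρ * q) := by
    refine (mul_le_mul_of_nonneg_left (hterm 0 _ ?_) (by positivity)).trans (le_of_eq ?_)
    · have : 0 ≤ (ρ ^ 2 / (e / 2 ^ 0) ^ 2 + 1) * h := by positivity
      linarith
    · field_simp; ring
  have hj : ∀ j ∈ Finset.range J, (9 * e / 2 ^ j) *
        Real.sqrt (2 * N * (2 * P + 2 * ((ρ ^ 2 / (e / 2 ^ (j + 1)) ^ 2 + 1) * h) + D)) ≤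
      36 * Real.sqrt N * e * B * (1 / 2) ^ j + 72 * Real.sqrt N * ρ * q := by
    intro j _
    refine (mul_le_mul_of_nonneg_left (hterm (j + 1) _ le_rfl) (by positivity)).trans (le_of_eq ?_)
    rw [div_pow, one_pow]
    field_simp; ring
  have hsum := Finset.sum_le_sum hj
  rw [Finset.sum_add_distrib, ← Finset.mul_sum, Finset.sum_const, Finset.card_range,
    nsmul_eq_mul] at hsum
  have hgeo : ∑ j ∈ Finset.range J, ((1 : ℝ) / 2) ^ j ≤ 2 := by
    exact sum_geometric_two_le J
  have hgeo' : 36 * Real.sqrt N * e * B * ∑ j ∈ Finset.range J, ((1 : ℝ) / 2) ^ j ≤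
      36 * Real.sqrt N * e * B * 2 := by gcongr
  have hJ : (0 : ℝ) ≤ J := Nat.cast_nonneg J
  have hx : 0 ≤ Real.sqrt N * ρ * q := by positivity
  have hx' : 0 ≤ J * (Real.sqrt N * ρ * q) := by positivity
  have hy : Real.sqrt N * (80 * e * B + 80 * (J + 1) * ρ * q) =
    80 * (Real.sqrt N * e * B) + 80 * (J * (Real.sqrt N * ρ * q)) + 80 * (Real.sqrt N * ρ * q) := by
    ring
  rw [hy]
  linarith

/-- The difference between the loss of `x ↦ A x` and that of the zero map, at inputs of norm at
most `b`. -/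
noncomputable def centeredLoss {C d : ℕ} {Y : Type*} (l : (Fin C → ℝ) → Y → ℝ) (b : ℝ)
    (A : Matrix (Fin C) (Fin d) ℝ) (z : EuclideanSpace ℝ (Fin d) × Y) : ℝ :=
  if ‖z.1‖ ≤ b then lossAt l A z - l 0 z.2 else 0

section

variable {C d : ℕ} {Y : Type*} {l : (Fin C → ℝ) → Y → ℝ} {lip : ℝ}

theorem abs_centeredLoss_sub_le (hlip0 : 0 ≤ lip)
    (hlip : ∀ u v y, |l u y - l v y| ≤ lip * ‖u - v‖) {b : ℝ}
    {A A' : Matrix (Fin C) (Fin d) ℝ} {z : EuclideanSpace ℝ (Fin d) × Y} {t : ℝ} (ht : 0 ≤ t)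
    (h : ‖z.1‖ ≤ b → ‖A.mulVec (WithLp.ofLp z.1) - A'.mulVec (WithLp.ofLp z.1)‖ ≤ t) :
    |centeredLoss l b A z - centeredLoss l b A' z| ≤ lip * t := by
  unfold centeredLoss
  split_ifs with hz
  · rw [sub_sub_sub_cancel_right]
    exact (hlip _ _ _).trans (mul_le_mul_of_nonneg_left (h hz) hlip0)
  · simp only [sub_self, abs_zero]; positivity

variable [MeasurableSpace Y]

theorem measurable_lossAt (hl : Measurable (Function.uncurry l)) (A : Matrix (Fin C) (Fin d) ℝ) :
    Measurable (lossAt l A) := by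
  have h1 : Measurable fun z : EuclideanSpace ℝ (Fin d) × Y =>
      (A.mulVec (WithLp.ofLp z.1), z.2) := by
    refine Measurable.prodMk ?_ measurable_snd
    have : Continuous fun x : EuclideanSpace ℝ (Fin d) => A.mulVec (WithLp.ofLp x) := by fun_prop
    exact this.measurable.comp measurable_fst
  exact hl.comp h1

theorem measurable_centeredLoss (hl : Measurable (Function.uncurry l)) (b : ℝ)
    (A : Matrix (Fin C) (Fin d) ℝ) : Measurable (centeredLoss l b A) := by
  refine Measurable.ite (measurableSet_le (by fun_prop) measurable_const) ?_ measurable_const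
  exact (measurable_lossAt hl A).sub
    (hl.comp (measurable_const.prodMk measurable_snd))

end

theorem norm_mulVec_sub_mulVec_le {C d : ℕ} (A A' : Fin C → Fin d → ℝ) {b : ℝ}
    {x : EuclideanSpace ℝ (Fin d)} (hx : ‖x‖ ≤ b) :
    ‖(Matrix.of A).mulVec (WithLp.ofLp x) - (Matrix.of A').mulVec (WithLp.ofLp x)‖ ≤
      d * b * dist A A' := by
  have hb := (norm_nonneg x).trans hx
  refine (pi_norm_le_iff_of_nonneg (by positivity)).mpr fun c => ?_
  rw [Pi.sub_apply, Matrix.mulVec, Matrix.mulVec, dotProduct, dotProduct, ← Finset.sum_sub_distrib]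
  refine (norm_sum_le _ _).trans
    ((Finset.sum_le_card_nsmul _ _ (b * dist A A') fun i _ => ?_).trans (le_of_eq ?_))
  · rw [← sub_mul, norm_mul, mul_comm b]
    refine mul_le_mul ?_ ((PiLp.norm_apply_le x i).trans hx) (norm_nonneg _) dist_nonneg
    rw [← dist_eq_norm]
    exact (dist_le_pi_dist (A c) (A' c) i).trans (dist_le_pi_dist A A' c)
  · simp; ring

-- At level j the outputs are covered to accuracy of order e/(2^j lip), so the loss varies by at
-- most 3e/2^j in a cell: e/2^j from rounding and 2e/2^j from the remainder. The difference over two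
-- samples doubles this to 6e/2^j.
open Classical in
theorem card_signed_centeredLoss_le {C d r N : ℕ} {Y : Type*} {l : (Fin C → ℝ) → Y → ℝ}
    {lip a R b e : ℝ} (hlip0 : 0 < lip) (hlip : ∀ u v y, |l u y - l v y| ≤ lip * ‖u - v‖)
    (ha : 0 < a) (hR : 0 ≤ R) (hb : 0 < b) (he : 0 < e) {n J : ℕ} (hn : 0 < n)
    (hnJ : lip * (2 * r * d * a * b / n) ≤ e / 2 ^ J) {ι : Type*}
    (M : ι → Matrix (Fin C) (Fin d) ℝ) (hM : ∀ i, M i ∈ lowRankAdd C d r a R)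
    (hMe : ∀ i z, |centeredLoss l b (M i) z| ≤ e) {δ : ℝ} (hδ : 0 < δ)
    (z z' : Fin N → EuclideanSpace ℝ (Fin d) × Y) :
    ((Finset.univ.filter fun σ : Fin N → Bool => ∃ i,
      Real.sqrt N * (80 * e * (Real.sqrt (r * (C + d) * Real.log (2 * n + 1)) +
          Real.sqrt (Real.log (4 * N * C + 1)) + Real.sqrt (Real.log (1 / δ))) +
        80 * (J + 1) * (lip * b * R) * Real.sqrt (Real.log (4 * N * C + 1))) +
        N * (6 * e / 2 ^ J) <
      ∑ k, sgn (σ k) * (centeredLoss l b (M i) (z' k) - centeredLoss l b (M i) (z k))).card : ℝ) ≤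
      (J + 1) * δ * 2 ^ N := by
  rcases isEmpty_or_nonempty ι with hι | hι
  · simp only [IsEmpty.exists_iff, Finset.filter_false, Finset.card_empty, Nat.cast_zero]
    positivity
  set P : ℝ := r * (C + d) * Real.log (2 * n + 1) with hP
  set h : ℝ := Real.log (4 * N * C + 1) with hh
  set ρ : ℝ := lip * b * R with hρ
  have hP0 : 0 ≤ P := by
    have : 0 ≤ Real.log (2 * (n : ℝ) + 1) := Real.log_nonneg (by
      have : (0 : ℝ) ≤ n := Nat.cast_nonneg n
      linarith)
    positivity
  have hh0 : 0 ≤ h := Real.log_nonneg (by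
    have : (0 : ℝ) ≤ 4 * N * C := by positivity
    linarith)
  -- Points outside the ball are moved to 0; the centered loss vanishes there for every matrix
  -- anyway.
  let x : Fin N ⊕ Fin N → EuclideanSpace ℝ (Fin d) := fun s =>
    let y := (Sum.elim z z' s).1
    if ‖y‖ ≤ b then y else 0
  have hx : ∀ s, ‖x s‖ ≤ b := by
    intro s
    simp only [x]
    split_ifs with h
    · exact h
    · simpa using hb.le
  let ε : ℕ → ℝ := fun j => e / 2 ^ j / lip
  have hε : ∀ j, 0 < ε j := fun j => by positivity
  choose K hK κ hcard hclose using fun j =>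
    exists_cells (C := C) (r := r) (R := R) ha hb (hε j) hn x hx
  let g : ι → Fin N ⊕ Fin N → ℝ := fun i s => centeredLoss l b (M i) (Sum.elim z z' s)
  let v : ι → Fin N → ℝ := fun i k => g i (Sum.inr k) - g i (Sum.inl k)
  have hv : ∀ i k, |v i k| ≤ 2 * e := by
    intro i k
    have e1 := abs_le.mp (hMe i (z' k))
    have e2 := abs_le.mp (hMe i (z k))
    rw [abs_le]
    simp only [v, g, Sum.elim_inr, Sum.elim_inl]
    constructor <;> linarith [e1.1, e1.2, e2.1, e2.2]
  have hg : ∀ j ≤ J, ∀ i i', κ j ⟨M i, hM i⟩ = κ j ⟨M i', hM i'⟩ → ∀ s,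
      |g i s - g i' s| ≤ 3 * e / 2 ^ j := by
    intro j hj i i' hii s
    have h1 := abs_centeredLoss_sub_le hlip0.le hlip (b := b) (A := M i) (A' := M i')
      (z := Sum.elim z z' s) (t := 2 * r * d * a * b / n + 2 * ε j)
      (by have := (hε j).le; positivity) fun hz => by
        have := hclose j _ _ hii s
        simpa only [x, hz, if_true] using this
    refine h1.trans ?_
    have h2 : e / 2 ^ J ≤ e / 2 ^ j := by
      have : (2 : ℝ) ^ j ≤ 2 ^ J := pow_le_pow_right₀ (by norm_num) hj
      gcongr
    have h3 : lip * (2 * ε j) = 2 * (e / 2 ^ j) := by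
      simp only [ε]; field_simp
    rw [mul_add, h3]
    have h4 : 3 * e / 2 ^ j = 3 * (e / 2 ^ j) := by ring
    rw [h4]; linarith
  have hchain := card_chaining_le v hv J K (fun j i => κ j ⟨M i, hM i⟩) (fun j => 6 * e / 2 ^ j)
    (fun j hj i i' hii k => by
      have e1 := abs_le.mp (hg j hj i i' hii (Sum.inr k))
      have e2 := abs_le.mp (hg j hj i i' hii (Sum.inl k))
      have h4 : 6 * e / 2 ^ j = 3 * e / 2 ^ j + 3 * e / 2 ^ j := by ring
      rw [h4, abs_le]
      simp only [v]
      constructor <;> linarith [e1.1, e1.2, e2.1, e2.2]) hδ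
  refine le_trans ?_ hchain
  have hKpos : ∀ j, (0 : ℝ) < Fintype.card (K j) := fun j => by
    obtain ⟨i⟩ := hι
    have : Nonempty (K j) := ⟨κ j ⟨M i, hM i⟩⟩
    exact_mod_cast Fintype.card_pos
  have hcard' : ∀ j, Real.log (Fintype.card (K j)) ≤ P + (ρ ^ 2 / (e / 2 ^ j) ^ 2 + 1) * h := by
    intro j
    refine (hcard j).trans (le_of_eq ?_)
    have h1 : (Fintype.card (Fin N ⊕ Fin N) : ℝ) = 2 * N := by
      simp; ring
    have h2 : R ^ 2 * b ^ 2 / ε j ^ 2 = ρ ^ 2 / (e / 2 ^ j) ^ 2 := by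
      simp only [ε, hρ]; field_simp
    rw [h1, h2, hP, hh]
    congr 4; ring
  have hsum := chaining_sum_le (D := Real.log (1 / δ)) (N := N) he (by positivity : 0 ≤ ρ) hP0 hh0
    (Nat.cast_nonneg N) J
  rw [one_div, Real.log_inv] at hsum
  refine Nat.cast_le.mpr (Finset.card_le_card fun σ hσ => ?_)
  rw [Finset.mem_filter] at hσ ⊢
  refine ⟨hσ.1, ?_⟩
  obtain ⟨i, hi⟩ := hσ.2
  refine ⟨i, lt_of_le_of_lt ?_ hi⟩
  refine add_le_add_left (le_trans ?_ (by simpa only [one_div, Real.log_inv] using hsum)) _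
  refine add_le_add ?_ (Finset.sum_le_sum fun j _ => ?_)
  · rw [Real.log_div (hKpos 0).ne' hδ.ne']
    have := hcard' 0
    gcongr
    linarith
  · rw [Real.log_div (mul_pos (hKpos j) (hKpos (j + 1))).ne' hδ.ne',
      Real.log_mul (hKpos j).ne' (hKpos (j + 1)).ne']
    have h1 := hcard' j
    have h2 := hcard' (j + 1)
    have h3 : (ρ ^ 2 / (e / 2 ^ j) ^ 2 + 1) * h ≤ (ρ ^ 2 / (e / 2 ^ (j + 1)) ^ 2 + 1) * h := by
      have : (2 : ℝ) ^ j ≤ 2 ^ (j + 1) := pow_le_pow_right₀ (by norm_num) (Nat.le_succ j)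
      gcongr
    have h4 : 6 * e / 2 ^ j + 6 * e / 2 ^ (j + 1) = 9 * e / 2 ^ j := by
      rw [pow_succ]; field_simp; ring
    rw [h4]
    gcongr
    linarith

/-- Uniform deviation over a class of matrices, with the norm bound on the inputs built into the
loss. -/
theorem measure_exists_lowRankAdd_deviation_le {C d r N : ℕ} {Y : Type*} [MeasurableSpace Y]
    (D : Measure (EuclideanSpace ℝ (Fin d) × Y)) [IsProbabilityMeasure D]
    {l : (Fin C → ℝ) → Y → ℝ} (hl : Measurable (Function.uncurry l))
    {lip a R b e : ℝ} (hlip0 : 0 < lip) (hlip : ∀ u v y, |l u y - l v y| ≤ lip * ‖u - v‖)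
    (ha : 0 < a) (hR : 0 ≤ R) (hb : 0 < b) (he : 0 < e) {n J : ℕ} (hn : 0 < n) (hN : 0 < N)
    (hnJ : lip * (2 * r * d * a * b / n) ≤ e / 2 ^ J) (hJ : Real.sqrt N ≤ 2 ^ J)
    {δ : ℝ} (hδ : 0 < δ) :
    Measure.pi (fun _ : Fin N => D)
      {S | ∃ A ∈ lowRankAdd C d r a R, (∀ z, |centeredLoss l b A z| ≤ e) ∧
        (80 * e * (Real.sqrt (r * (C + d) * Real.log (2 * n + 1)) +
          Real.sqrt (Real.log (4 * N * C + 1)) + Real.sqrt (Real.log (1 / δ))) +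
        80 * (J + 1) * (lip * b * R) * Real.sqrt (Real.log (4 * N * C + 1)) + 8 * e) /
          Real.sqrt N <
        ∫ z, centeredLoss l b A z ∂D - 1 / N * ∑ k, centeredLoss l b A (S k)} ≤
      ENNReal.ofReal (2 * ((J + 1) * δ)) := by
  have hN' : (0 : ℝ) < N := by exact_mod_cast hN
  have hsN : 0 < Real.sqrt N := Real.sqrt_pos.mpr hN'
  let 𝒜 : Set (Fin C → Fin d → ℝ) :=
    {A | Matrix.of A ∈ lowRankAdd C d r a R ∧ ∀ z, |centeredLoss l b (Matrix.of A) z| ≤ e}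
  -- Symmetrization needs a countable family. The deviation is Lipschitz in the matrix, so a strict
  -- excess at `A` persists at a nearby element of a countable dense subset.
  obtain ⟨c, hc𝒜, hcc, hcd⟩ :=
    (TopologicalSpace.IsSeparable.of_separableSpace 𝒜).exists_countable_dense_subset
  have := hcc.to_subtype
  set X : ℝ := 80 * e * (Real.sqrt (r * (C + d) * Real.log (2 * n + 1)) +
          Real.sqrt (Real.log (4 * N * C + 1)) + Real.sqrt (Real.log (1 / δ))) +
        80 * (J + 1) * (lip * b * R) * Real.sqrt (Real.log (4 * N * C + 1)) with hX
  set u : ℝ := X / Real.sqrt N + 6 * e / 2 ^ J with hu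
  have hmeas := measure_exists_deviation_le D (g := fun A : c => centeredLoss l b (Matrix.of A.1))
    (fun A => measurable_centeredLoss hl b _) he (fun A => (hc𝒜 A.2).2) hN (u := u)
    (δ := (J + 1) * δ) (fun z z' => by
      have h1 := card_signed_centeredLoss_le hlip0 hlip ha hR hb he hn hnJ
        (fun A : c => Matrix.of A.1) (fun A => (hc𝒜 A.2).1) (fun A => (hc𝒜 A.2).2) hδ z z'
      have h2 : (N : ℝ) * u = Real.sqrt N * X + N * (6 * e / 2 ^ J) := by
        rw [hu, mul_add]
        congr 1
        have h3 := Real.mul_self_sqrt hN'.le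
        rw [← mul_div_assoc, div_eq_iff hsN.ne', mul_right_comm, h3]
      rw [h2]
      convert h1)
  refine (measure_mono ?_).trans hmeas
  rintro S ⟨A₀, hA, hAe, hlt⟩
  obtain ⟨A, rfl⟩ : ∃ A : Fin C → Fin d → ℝ, Matrix.of A = A₀ := ⟨A₀, rfl⟩
  -- The 8e collects the last chaining link, 6e/2^J ≤ 6e/√N, and the 2e/√N lost in symmetrization.
  have hle : u + 2 * e / Real.sqrt N ≤ (X + 8 * e) / Real.sqrt N := by
    have : 6 * e / 2 ^ J ≤ 6 * e / Real.sqrt N := by gcongr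
    have h4 : (X + 8 * e) / Real.sqrt N =
      X / Real.sqrt N + 6 * e / Real.sqrt N + 2 * e / Real.sqrt N := by ring
    rw [hu, h4]; linarith
  let Φ : (Fin C → Fin d → ℝ) → ℝ := fun A =>
    ∫ z, centeredLoss l b (Matrix.of A) z ∂D - 1 / N * ∑ k, centeredLoss l b (Matrix.of A) (S k)
  have hdiff : ∀ (A A' : Fin C → Fin d → ℝ) z,
      |centeredLoss l b (Matrix.of A) z - centeredLoss l b (Matrix.of A') z| ≤
        lip * (d * b * dist A A') := fun A A' z =>
    abs_centeredLoss_sub_le hlip0.le hlip (by positivity) (norm_mulVec_sub_mulVec_le A A')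
  have hint : ∀ A ∈ 𝒜, Integrable (centeredLoss l b (Matrix.of A)) D := fun A hA =>
    Integrable.of_bound (measurable_centeredLoss hl b _).aestronglyMeasurable e
      (ae_of_all _ fun z => hA.2 z)
  have hA𝒜 : A ∈ 𝒜 := ⟨hA, hAe⟩
  have hΦ : ∀ A ∈ 𝒜, ∀ A' ∈ 𝒜, Φ A - Φ A' ≤ 2 * (lip * (d * b * dist A A')) := by
    intro A hA A' hA'
    have h1 : ∫ z, centeredLoss l b (Matrix.of A) z ∂D -
        ∫ z, centeredLoss l b (Matrix.of A') z ∂D ≤ lip * (d * b * dist A A') := by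
      rw [← integral_sub (hint A hA) (hint A' hA')]
      refine (integral_mono ((hint A hA).sub (hint A' hA')) (integrable_const _)
        fun z => (le_abs_self _).trans (hdiff A A' z)).trans ?_
      simp
    have h2 : 1 / (N : ℝ) * ∑ k, centeredLoss l b (Matrix.of A') (S k) -
        1 / N * ∑ k, centeredLoss l b (Matrix.of A) (S k) ≤ lip * (d * b * dist A A') := by
      rw [← mul_sub, ← Finset.sum_sub_distrib]
      have h3 : ∑ k, (centeredLoss l b (Matrix.of A') (S k) -
          centeredLoss l b (Matrix.of A) (S k)) ≤ N * (lip * (d * b * dist A A')) := by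
        refine (Finset.sum_le_card_nsmul _ _ (lip * (d * b * dist A A')) fun k _ => ?_).trans
          (by simp)
        rw [dist_comm]
        exact (le_abs_self _).trans (hdiff A' A (S k))
      rw [one_div, inv_mul_le_iff₀ hN']
      exact h3
    simp only [Φ]; linarith
  have hgap : u + 2 * e / Real.sqrt N < Φ A := lt_of_le_of_lt hle hlt
  set s := Φ A - (u + 2 * e / Real.sqrt N) with hs
  have hs0 : 0 < s := sub_pos.mpr hgap
  have hden : 0 < 2 * (lip * (d * b)) + 1 := by positivity
  obtain ⟨A', hA'c, hA'⟩ := Metric.mem_closure_iff.mp (hcd hA𝒜) (s / (2 * (lip * (d * b)) + 1))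
    (by positivity)
  refine ⟨⟨A', hA'c⟩, ?_⟩
  have h5 := hΦ A hA𝒜 A' (hc𝒜 hA'c)
  rw [lt_div_iff₀ hden] at hA'
  have h6 : 2 * (lip * (d * b * dist A A')) ≤ dist A A' * (2 * (lip * (d * b)) + 1) := by
    have := dist_nonneg (x := A) (y := A')
    nlinarith
  have h7 : u + 2 * e / Real.sqrt N < Φ A' := by linarith
  exact h7

end LinNet

/-! ### Mass beyond the sample maximum, and the union bound over classes. -/

namespace LinNet

/-- With high probability the mass beyond the largest value in a sample is small. -/
theorem measure_tail_beyond_max_le {Z : Type*} [MeasurableSpace Z] (D : Measure Z)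
    [IsProbabilityMeasure D] {φ : Z → ℝ} (hφ : Measurable φ) {N : ℕ} {u : ℝ} (hu : 0 ≤ u) :
    Measure.pi (fun _ : Fin N => D) {S | u < D.real {z | ⨆ i, φ (S i) < φ z}} ≤
      ENNReal.ofReal (Real.exp (-(N * u))) := by
  set μ := Measure.pi (fun _ : Fin N => D) with hμ
  -- The bad event is a union over rational levels `q` of tail mass above `u` with the whole sample
  -- below `q`. These events increase with `q`, so the supremum of their probabilities suffices.
  let Q := {q : ℚ // u < D.real {z | (q : ℝ) < φ z}}
  let A : Q → Set (Fin N → Z) := fun q => Set.univ.pi fun _ => {z | φ z ≤ (q.1 : ℝ)}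
  have hsub : {S : Fin N → Z | u < D.real {z | ⨆ i, φ (S i) < φ z}} ⊆ ⋃ q, A q := by
    intro S hS
    set m := ⨆ i, φ (S i) with hm
    have hset : {z | m < φ z} = ⋃ q : {q : ℚ // m < q}, {z | (q.1 : ℝ) < φ z} := by
      ext z
      simp only [Set.mem_ofPred_eq, Set.mem_iUnion, Subtype.exists, exists_prop]
      constructor
      · intro h
        obtain ⟨q, h1, h2⟩ := exists_rat_btwn h
        exact ⟨q, h1, h2⟩
      · rintro ⟨q, h1, h2⟩
        exact h1.trans h2
    have hdir : Directed (· ⊆ ·) fun q : {q : ℚ // m < q} => {z | (q.1 : ℝ) < φ z} := by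
      intro p q
      rcases le_total p.1 q.1 with h | h
      · have h' : (p.1 : ℝ) ≤ q.1 := by exact_mod_cast h
        exact ⟨p, subset_rfl, fun z hz => lt_of_le_of_lt h' hz⟩
      · have h' : (q.1 : ℝ) ≤ p.1 := by exact_mod_cast h
        exact ⟨q, fun z hz => lt_of_le_of_lt h' hz, subset_rfl⟩
    have hlt : ENNReal.ofReal u < D {z | m < φ z} := by
      rw [← ofReal_measureReal]
      exact (ENNReal.ofReal_lt_ofReal_iff_of_nonneg hu).mpr hS
    rw [hset, hdir.measure_iUnion, lt_iSup_iff] at hlt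
    obtain ⟨q, hq⟩ := hlt
    rw [← ofReal_measureReal, ENNReal.ofReal_lt_ofReal_iff_of_nonneg hu] at hq
    refine Set.mem_iUnion.mpr ⟨⟨q.1, hq⟩, fun i _ => ?_⟩
    exact (le_ciSup (Set.finite_range fun i => φ (S i)).bddAbove i).trans q.2.le
  have hdir : Directed (· ⊆ ·) A := by
    intro p q
    rcases le_total p.1 q.1 with h | h
    · have h' : ((p.1 : ℚ) : ℝ) ≤ (q.1 : ℚ) := by exact_mod_cast h
      exact ⟨q, Set.pi_mono fun _ _ z hz => le_trans hz h', subset_rfl⟩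
    · have h' : ((q.1 : ℚ) : ℝ) ≤ (p.1 : ℚ) := by exact_mod_cast h
      exact ⟨p, subset_rfl, Set.pi_mono fun _ _ z hz => le_trans hz h'⟩
  refine (measure_mono hsub).trans ?_
  rw [hdir.measure_iUnion]
  refine iSup_le fun q => ?_
  have hmeas : MeasurableSet {z | (q.1 : ℝ) < φ z} := measurableSet_lt measurable_const hφ
  have hcompl : {z | φ z ≤ (q.1 : ℝ)} = {z | (q.1 : ℝ) < φ z}ᶜ := by ext; simp
  have h1 : D {z | φ z ≤ (q.1 : ℝ)} ≤ ENNReal.ofReal (Real.exp (-u)) := by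
    rw [hcompl, ← ofReal_measureReal, probReal_compl_eq_one_sub hmeas]
    refine ENNReal.ofReal_le_ofReal ?_
    have := Real.add_one_le_exp (-u)
    linarith [q.2]
  simp only [A, hμ, Measure.pi_pi, Finset.prod_const, Finset.card_univ, Fintype.card_fin]
  calc _ ≤ ENNReal.ofReal (Real.exp (-u)) ^ N := by gcongr
    _ = _ := by
      rw [← ENNReal.ofReal_pow (Real.exp_pos _).le, ← Real.exp_nat_mul]
      congr 2; ring

theorem measure_exists_nat_le {Ω : Type*} [MeasurableSpace Ω] (μ : Measure Ω) {p : ℕ → Ω → Prop}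
    {c : ℝ} (hc : 0 ≤ c)
    (h : ∀ k, μ {ω | p k ω} ≤ ENNReal.ofReal (c * (1 / 2) ^ (k + 1))) :
    μ {ω | ∃ k, p k ω} ≤ ENNReal.ofReal c := by
  have hset : {ω | ∃ k, p k ω} = ⋃ k, {ω | p k ω} := by ext; simp
  rw [hset]
  refine (measure_iUnion_le _).trans ((ENNReal.tsum_le_tsum h).trans (le_of_eq ?_))
  have hs : HasSum (fun k : ℕ => c * (1 / 2 : ℝ) ^ (k + 1)) c := by
    have h2 : (fun k : ℕ => c * (1 / 2 : ℝ) ^ (k + 1)) = fun k => c / 2 / 2 ^ k := by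
      funext k
      rw [pow_succ, one_div, inv_pow]
      field_simp
    rw [h2]
    exact hasSum_geometric_two' c
  rw [← ENNReal.ofReal_tsum_of_nonneg (fun k => by positivity) hs.summable, hs.tsum_eq]

theorem measure_exists_nat₄_le {Ω : Type*} [MeasurableSpace Ω] (μ : Measure Ω)
    {p : ℕ → ℕ → ℕ → ℕ → Ω → Prop} {c : ℝ} (hc : 0 ≤ c)
    (h : ∀ i j k m, μ {ω | p i j k m ω} ≤ ENNReal.ofReal (c * (1 / 2) ^ (i + j + k + m + 4))) :
    μ {ω | ∃ i j k m, p i j k m ω} ≤ ENNReal.ofReal c := by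
  refine measure_exists_nat_le μ hc fun i => measure_exists_nat_le μ (by positivity) fun j =>
    measure_exists_nat_le μ (by positivity) fun k => measure_exists_nat_le μ (by positivity)
      fun m => (h i j k m).trans (le_of_eq ?_)
  congr 1; ring

/-- Expectation minus average of the centered loss. -/
noncomputable def centeredGap {C d N : ℕ} {Y : Type*} [MeasurableSpace Y]
    (D : Measure (EuclideanSpace ℝ (Fin d) × Y)) (l : (Fin C → ℝ) → Y → ℝ) (b : ℝ)
    (A : Matrix (Fin C) (Fin d) ℝ) (S : Fin N → EuclideanSpace ℝ (Fin d) × Y) : ℝ :=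
  ∫ z, centeredLoss l b A z ∂D - 1 / N * ∑ k, centeredLoss l b A (S k)

/-- The bound on the deviation over a class `lowRankAdd`. -/
noncomputable def devBound (C d r n J N : ℕ) (e ρ δ : ℝ) : ℝ :=
  (80 * e * (Real.sqrt (r * (C + d) * Real.log (2 * n + 1)) +
      Real.sqrt (Real.log (4 * N * C + 1)) + Real.sqrt (Real.log (1 / δ))) +
    80 * (J + 1) * ρ * Real.sqrt (Real.log (4 * N * C + 1)) + 8 * e) / Real.sqrt N

/-- The share of the failure probability that is given to a class. -/
noncomputable def share (δ : ℝ) (J i₁ i₂ j r : ℕ) : ℝ :=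
  δ / (8 * (J + 1)) * (1 / 2) ^ (i₁ + i₂ + j + r + 4)

theorem share_pos {δ : ℝ} (hδ : 0 < δ) (J i₁ i₂ j r : ℕ) : 0 < share δ J i₁ i₂ j r := by
  unfold share; positivity

/-- Uniform deviation over countably many classes. -/
theorem measure_exists_class_deviation_le {C d : ℕ} {Y : Type*} [MeasurableSpace Y]
    (D : Measure (EuclideanSpace ℝ (Fin d) × Y)) [IsProbabilityMeasure D]
    {l : (Fin C → ℝ) → Y → ℝ} (hl : Measurable (Function.uncurry l)) {lip : ℝ} (hlip0 : 0 < lip)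
    (hlip : ∀ u v y, |l u y - l v y| ≤ lip * ‖u - v‖) {N : ℕ} (hN : 0 < N) {δ : ℝ} (hδ : 0 < δ)
    (J : ℕ) (hJ : Real.sqrt N ≤ 2 ^ J)
    (e : ℕ → ℝ) (he : ∀ j, 0 < e j) (T : ℕ → ℝ) (hT : ∀ j, 0 < T j) (ρ : ℕ → ℕ → ℝ)
    (hρ : ∀ j r, 0 ≤ ρ j r) (n : ℕ → ℕ → ℕ) (hn : ∀ j r, 0 < n j r) (ok : ℕ → Prop)
    (hnJ : ∀ j r, ok r → 2 * r * d * T j / n j r ≤ e j / 2 ^ J) :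
    Measure.pi (fun _ : Fin N => D) {S | ∃ i₁ i₂ j r : ℕ, ok r ∧
      ∃ A ∈ lowRankAdd C d r (T j / (lip * (2 ^ i₁ / 2 ^ i₂))) (ρ j r / (lip * (2 ^ i₁ / 2 ^ i₂))),
        (∀ z, |centeredLoss l (2 ^ i₁ / 2 ^ i₂) A z| ≤ e j) ∧
        devBound C d r (n j r) J N (e j) (ρ j r) (share δ J i₁ i₂ j r) <
          centeredGap D l (2 ^ i₁ / 2 ^ i₂) A S} ≤ ENNReal.ofReal (δ / 4) := by
  refine measure_exists_nat₄_le _ (by positivity) fun i₁ i₂ j r => ?_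
  -- `ok` singles out the classes for which the grid is fine enough for chaining; the others
  -- contribute an empty event.
  by_cases hok : ok r
  swap
  · simp [hok]
  set b : ℝ := 2 ^ i₁ / 2 ^ i₂ with hb
  have hb0 : 0 < b := by positivity
  have hT' := hT j
  have hn' : (0 : ℝ) < n j r := by exact_mod_cast hn j r
  have h := measure_exists_lowRankAdd_deviation_le (r := r) D hl hlip0 hlip
    (a := T j / (lip * b)) (R := ρ j r / (lip * b)) (by positivity)
    (div_nonneg (hρ j r) (by positivity)) hb0 (he j) (hn j r) hN (J := J) (by
      refine le_trans (le_of_eq ?_) (hnJ j r hok)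
      field_simp) hJ (share_pos hδ J i₁ i₂ j r)
  refine le_trans (measure_mono ?_) (h.trans (ENNReal.ofReal_le_ofReal (le_of_eq ?_)))
  · rintro S ⟨-, A, hA, hAe, hlt⟩
    refine ⟨A, hA, hAe, ?_⟩
    have hR : lip * b * (ρ j r / (lip * b)) = ρ j r := by field_simp
    rw [hR]
    exact hlt
  -- The factor 8(J + 1) in `share` cancels the 2(J + 1) from symmetrization and chaining, leaving
  -- δ/4.
  · unfold share; field_simp; ring

theorem measure_const_loss_deviation_le {C d : ℕ} {Y : Type*} [MeasurableSpace Y]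
    (D : Measure (EuclideanSpace ℝ (Fin d) × Y)) [IsProbabilityMeasure D]
    {l : (Fin C → ℝ) → Y → ℝ} (hl : Measurable (Function.uncurry l)) {E : ℝ} (hE : 0 < E)
    (hlE : ∀ u y, 0 ≤ l u y ∧ l u y ≤ E) {N : ℕ} (hN : 0 < N) {δ : ℝ} (hδ : 0 < δ) (hδ1 : δ < 1) :
    Measure.pi (fun _ : Fin N => D)
      {S | 4 * E * Real.sqrt (Real.log (4 / δ) / N) <
        ∫ z, l 0 z.2 ∂D - 1 / N * ∑ k, l 0 (S k).2} ≤ ENNReal.ofReal (δ / 4) := by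
  have hN' : (0 : ℝ) < N := by exact_mod_cast hN
  have h := measure_exists_deviation_le D (ι := Unit) (g := fun _ z => l 0 z.2)
    (fun _ => hl.comp (measurable_const.prodMk measurable_snd)) hE
    (fun _ z => abs_le.mpr ⟨by linarith [(hlE 0 z.2).1], (hlE 0 z.2).2⟩) hN
    (u := E * Real.sqrt (2 * Real.log (1 / (δ / 8)) / N)) (δ := δ / 8) (fun z z' => by
      have h1 := card_signed_sum_gt_le (fun k => l 0 (z' k).2 - l 0 (z k).2) (M := E)
        (fun k => by
          have e1 := hlE 0 (z' k).2
          have e2 := hlE 0 (z k).2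
          rw [abs_le]; constructor <;> linarith [e1.1, e1.2, e2.1, e2.2])
        (δ := δ / 8) (by positivity)
      have h2 : (N : ℝ) * (E * Real.sqrt (2 * Real.log (1 / (δ / 8)) / N)) =
          E * Real.sqrt (2 * N * Real.log (1 / (δ / 8))) := by
        have h3 : 2 * N * Real.log (1 / (δ / 8)) =
            (N : ℝ) ^ 2 * (2 * Real.log (1 / (δ / 8)) / N) := by field_simp
        rw [h3, Real.sqrt_mul (by positivity), Real.sqrt_sq hN'.le]; ring
      rw [h2]
      convert h1 using 4
      simp)
  refine (measure_mono ?_).trans (h.trans (ENNReal.ofReal_le_ofReal (by linarith)))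
  intro S hS
  refine ⟨(), lt_of_le_of_lt ?_ hS⟩
  have hlog4 : 1 ≤ Real.log (4 / δ) := by
    rw [Real.le_log_iff_exp_le (by positivity)]
    have := Real.exp_one_lt_d9
    have h4 : (4 : ℝ) ≤ 4 / δ := by rw [le_div_iff₀ hδ]; linarith
    linarith
  have hlog8 : Real.log (1 / (δ / 8)) ≤ 2 * Real.log (4 / δ) := by
    rw [← Real.log_rpow (by positivity)]
    refine Real.log_le_log (by positivity) ?_
    norm_num
    rw [div_pow, div_le_div_iff₀ hδ (by positivity)]
    nlinarith
  have h1 : Real.sqrt (2 * Real.log (1 / (δ / 8)) / N) ≤ 2 * Real.sqrt (Real.log (4 / δ) / N) := by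
    rw [Real.sqrt_le_left (by positivity), mul_pow, Real.sq_sqrt (by positivity), ← mul_div_assoc]
    exact div_le_div_of_nonneg_right (by linarith) hN'.le
  have h2 : 1 / Real.sqrt N ≤ Real.sqrt (Real.log (4 / δ) / N) := by
    rw [Real.sqrt_div (by linarith)]
    gcongr
    rw [← Real.sqrt_one]
    exact Real.sqrt_le_sqrt hlog4
  have h3 : 2 * E / Real.sqrt N = 2 * E * (1 / Real.sqrt N) := by ring
  rw [h3]
  have h4 := mul_le_mul_of_nonneg_left h1 hE.le
  have h5 := mul_le_mul_of_nonneg_left h2 hE.le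
  linarith

end LinNet

/-! ### The complexity and the choice of the rank. -/

namespace LinNet

/-- The complexity term without its dimension factor. -/
noncomputable def complexity {L : ℕ} {w : ℕ → ℕ} (q : Fin L → ℝ) (B : Factors L w) (x : ℝ) : ℝ :=
  x ^ (2 * conjIndex q / (2 + conjIndex q)) * factorSum q B ^ (2 / (2 + conjIndex q))

theorem complexity_nonneg {L : ℕ} (hL : 0 < L) {w : ℕ → ℕ} (q : Fin L → ℝ) (B : Factors L w)
    {x : ℝ} (hx : 0 ≤ x) : 0 ≤ complexity q B x :=
  mul_nonneg (Real.rpow_nonneg hx _) (Real.rpow_nonneg (factorSum_nonneg hL q B) _)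

section

variable {L : ℕ} (hL : 0 < L) {w : ℕ → ℕ} {q : Fin L → ℝ} (hq : ∀ ℓ, 0 ≤ q ℓ ∧ q ℓ ≤ 1)
  (B : Factors L w) {x : ℝ} (hx : 0 < x)

theorem complexity_of_conjIndex_zero (hq' : ¬ ∀ ℓ, 0 < q ℓ) (x : ℝ) :
    complexity q B x = factorSum q B := by
  simp [complexity, conjIndex, hq']

include hL hq hx

/-- The case k = 0 of the decay bound says ‖A‖^p ≤ S, so s = 2p/(2+p) works. For p = 0 the exponent
is 0 and the claim is that a nonzero matrix has rank at least 1. -/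
theorem rpow_le_complexity (hA : 0 < specNorm (netMatrix B)) :
    ∃ s : ℝ, 0 ≤ s ∧ s ≤ 1 ∧ (x * specNorm (netMatrix B)) ^ s ≤ complexity q B x := by
  by_cases hq' : ∀ ℓ, 0 < q ℓ
  · have hp0 := conjIndex_pos hL hq'
    have hp1 := conjIndex_le_one hL fun ℓ => (hq ℓ).2
    have h1 := succ_mul_singularValues_rpow_le_factorSum hL hq' B 0
    rw [← specNorm_eq_singularValues_zero, Nat.cast_zero, zero_add, one_mul] at h1
    unfold complexity
    set p := conjIndex q
    refine ⟨2 * p / (2 + p), by positivity, ?_, ?_⟩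
    · rw [div_le_one (by positivity)]; linarith
    rw [Real.mul_rpow hx.le hA.le]
    gcongr
    have h2 := Real.rpow_le_rpow (by positivity) h1 (z := 2 / (2 + p)) (by positivity)
    rw [← Real.rpow_mul hA.le] at h2
    refine le_trans (le_of_eq ?_) h2
    congr 1; ring
  · refine ⟨0, le_rfl, zero_le_one, ?_⟩
    rw [complexity_of_conjIndex_zero B hq', Real.rpow_zero]
    refine le_trans ?_ (finrank_range_netMatrix_le_factorSum (fun ℓ => (hq ℓ).1) hq' B)
    rw [specNorm_eq_singularValues_zero, LinearMap.singularValues_pos_iff_lt_finrank_range] at hA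
    exact_mod_cast hA

theorem le_complexity_of_le_one (hA : 0 < specNorm (netMatrix B))
    (ht : x * specNorm (netMatrix B) ≤ 1) :
    x * specNorm (netMatrix B) ≤ complexity q B x := by
  obtain ⟨s, hs0, hs1, h⟩ := rpow_le_complexity hL hq B hx hA
  refine le_trans ?_ h
  conv_lhs => rw [← Real.rpow_one (x * specNorm (netMatrix B))]
  exact Real.rpow_le_rpow_of_exponent_ge (by positivity) ht hs1

theorem one_le_complexity (hA : 0 < specNorm (netMatrix B))
    (ht : 1 ≤ x * specNorm (netMatrix B)) : 1 ≤ complexity q B x := by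
  obtain ⟨s, hs0, hs1, h⟩ := rpow_le_complexity hL hq B hx hA
  exact (Real.one_le_rpow ht hs0).trans h

/-- The number of large singular values is controlled by the complexity. -/
theorem mul_singularValues_ceil_complexity_le (hG : 0 < complexity q B x) :
    x * (Matrix.toEuclideanLin (netMatrix B)).singularValues ⌈complexity q B x⌉₊ ≤
      Real.sqrt (complexity q B x) := by
  set G := complexity q B x with hGdef
  set r := ⌈G⌉₊
  have hGr : G ≤ r := Nat.le_ceil G
  have hσ0 := LinearMap.singularValues_nonneg (Matrix.toEuclideanLin (netMatrix B)) r
  by_cases hq' : ∀ ℓ, 0 < q ℓ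
  · have hp0 := conjIndex_pos hL hq'
    have h1 := succ_mul_singularValues_rpow_le_factorSum hL hq' B r
    have hS0 := factorSum_nonneg hL q B
    set σ := (Matrix.toEuclideanLin (netMatrix B)).singularValues r
    unfold complexity at hGdef
    set p := conjIndex q
    set F := factorSum q B
    have h2 : G * σ ^ p ≤ F := le_trans (by gcongr; linarith) h1
    -- This identity is why the exponents 2p/(2+p) and 2/(2+p) appear: with Gσ^p ≤ F it gives
    -- G(xσ)^p ≤ G · G^(p/2).
    have hGp : G ^ ((2 + p) / 2) = x ^ p * F := by
      rw [hGdef, Real.mul_rpow (by positivity) (by positivity), ← Real.rpow_mul hx.le,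
        ← Real.rpow_mul hS0]
      have e1 : 2 * p / (2 + p) * ((2 + p) / 2) = p := by field_simp
      have e2 : 2 / (2 + p) * ((2 + p) / 2) = 1 := by field_simp
      rw [e1, e2, Real.rpow_one]
    have h3 : G * (x * σ) ^ p ≤ G * Real.sqrt G ^ p := by
      rw [Real.mul_rpow hx.le hσ0]
      calc G * (x ^ p * σ ^ p) = x ^ p * (G * σ ^ p) := by ring
        _ ≤ x ^ p * F := by gcongr
        _ = G * Real.sqrt G ^ p := by
          rw [← hGp, Real.sqrt_eq_rpow, ← Real.rpow_mul hG.le]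
          nth_rewrite 2 [← Real.rpow_one G]
          rw [← Real.rpow_add hG]
          congr 1; ring
    have h4 := le_of_mul_le_mul_left h3 hG
    exact (Real.rpow_le_rpow_iff (by positivity) (Real.sqrt_nonneg _) hp0).mp h4
  · have h1 := finrank_range_netMatrix_le_factorSum (fun ℓ => (hq ℓ).1) hq' B
    rw [← complexity_of_conjIndex_zero B hq' x] at h1
    have h2 : Module.finrank ℝ (Matrix.toEuclideanLin (netMatrix B)).range ≤ r := by
      exact_mod_cast h1.trans hGr
    rw [(LinearMap.singularValues_eq_zero_iff_le_finrank_range _).mpr h2, mul_zero]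
    exact Real.sqrt_nonneg _

/-- The rank is ⌈G⌉ capped at the input dimension, beyond which singular values vanish. Since G ≥ 1,
rounding up at most doubles it. -/
theorem exists_rank_index (hA : 0 < specNorm (netMatrix B))
    (ht : 1 ≤ x * specNorm (netMatrix B)) :
    ∃ r : ℕ, 1 ≤ r ∧ r ≤ w 0 ∧ (r : ℝ) ≤ 2 * complexity q B x ∧
      x * (Matrix.toEuclideanLin (netMatrix B)).singularValues r ≤ Real.sqrt r := by
  have hG := one_le_complexity hL hq B hx hA ht
  have hσ := mul_singularValues_ceil_complexity_le hL hq B hx (by linarith)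
  set G := complexity q B x
  have hd : 1 ≤ w 0 := by
    by_contra hd
    rw [specNorm_eq_singularValues_zero, LinearMap.singularValues_of_finrank_le] at hA
    · exact lt_irrefl _ hA
    · simp; omega
  have hceil : (⌈G⌉₊ : ℝ) < G + 1 := Nat.ceil_lt_add_one (by linarith)
  refine ⟨min ⌈G⌉₊ (w 0), le_min (Nat.one_le_ceil_iff.mpr (by linarith)) hd, min_le_right _ _,
    ?_, ?_⟩
  · have : ((min ⌈G⌉₊ (w 0) : ℕ) : ℝ) ≤ ⌈G⌉₊ := by exact_mod_cast min_le_left _ _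
    linarith
  · rcases le_total ⌈G⌉₊ (w 0) with h | h
    · rw [min_eq_left h]
      exact hσ.trans (Real.sqrt_le_sqrt (Nat.le_ceil G))
    · rw [min_eq_right h, LinearMap.singularValues_of_finrank_le _ (by simp), mul_zero]
      exact Real.sqrt_nonneg _

end

theorem exists_two_pow_near {x : ℝ} (hx : 1 ≤ x) : ∃ i : ℕ, x ≤ 2 ^ i ∧ (2 : ℝ) ^ i ≤ 2 * x := by
  obtain ⟨n, h1, h2⟩ := exists_nat_pow_near hx (one_lt_two (α := ℝ))
  exact ⟨n + 1, h2.le, by rw [pow_succ]; linarith⟩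

/-- The last two bounds limit the cost of the indices in the union bound, where a class weighs
2^(-i₁-i₂). -/
theorem exists_dyadic_near {x : ℝ} (hx : 0 < x) : ∃ i₁ i₂ : ℕ, x ≤ (2 : ℝ) ^ i₁ / 2 ^ i₂ ∧
    (2 : ℝ) ^ i₁ / 2 ^ i₂ ≤ 2 * x ∧ (2 : ℝ) ^ i₁ ≤ 2 * x + 1 ∧ (2 : ℝ) ^ i₂ ≤ 1 / x + 1 := by
  rcases le_total 1 x with h | h
  · obtain ⟨i, h1, h2⟩ := exists_two_pow_near h
    have : 0 < 1 / x := by positivity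
    exact ⟨i, 0, by simpa using h1, by simpa using h2, by linarith, by simpa using hx.le⟩
  · obtain ⟨n, h1, h2⟩ := exists_nat_pow_near ((one_le_div hx).mpr h) (one_lt_two (α := ℝ))
    have hp : (0 : ℝ) < 2 ^ n := by positivity
    rw [le_div_iff₀ hx] at h1
    rw [div_lt_iff₀ hx, pow_succ] at h2
    refine ⟨0, n, ?_, ?_, ?_, ?_⟩
    · rw [pow_zero, le_div_iff₀ hp]; linarith
    · rw [pow_zero, div_le_iff₀ hp]; linarith
    · rw [pow_zero]; linarith
    · have : (2 : ℝ) ^ n ≤ 1 / x := by rw [le_div_iff₀ hx]; linarith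
      linarith

/-! ### From the gap to the centered gap. -/

section Reduction

set_option linter.unusedSectionVars false

variable {C d N : ℕ} {Y : Type*} [MeasurableSpace Y] {D : Measure (EuclideanSpace ℝ (Fin d) × Y)}
  [IsProbabilityMeasure D] {l : (Fin C → ℝ) → Y → ℝ} {E lip : ℝ}

theorem abs_centeredLoss_le_range (hlE : ∀ u y, 0 ≤ l u y ∧ l u y ≤ E) (hE : 0 ≤ E) (b : ℝ)
    (A : Matrix (Fin C) (Fin d) ℝ) (z : EuclideanSpace ℝ (Fin d) × Y) :
    |centeredLoss l b A z| ≤ E := by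
  unfold centeredLoss lossAt
  split_ifs
  · have e1 := hlE (A.mulVec (WithLp.ofLp z.1)) z.2
    have e2 := hlE 0 z.2
    rw [abs_le]; constructor <;> linarith [e1.1, e1.2, e2.1, e2.2]
  · simpa using hE

theorem abs_centeredLoss_le_norm (hlip0 : 0 ≤ lip)
    (hlip : ∀ u v y, |l u y - l v y| ≤ lip * ‖u - v‖) {b : ℝ} (hb : 0 ≤ b)
    (A : Matrix (Fin C) (Fin d) ℝ) (z : EuclideanSpace ℝ (Fin d) × Y) :
    |centeredLoss l b A z| ≤ lip * (specNorm A * b) := by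
  have hA := specNorm_nonneg A
  unfold centeredLoss lossAt
  split_ifs with hz
  · refine (hlip _ _ _).trans (mul_le_mul_of_nonneg_left ?_ hlip0)
    rw [sub_zero]
    exact (norm_mulVec_le A z.1).trans (by gcongr)
  · rw [abs_zero]; positivity

theorem norm_le_maxInput (S : Fin N → EuclideanSpace ℝ (Fin d) × Y) (i : Fin N) :
    ‖(S i).1‖ ≤ maxInput S :=
  le_ciSup (Set.finite_range fun i => ‖(S i).1‖).bddAbove i

theorem maxInput_nonneg (S : Fin N → EuclideanSpace ℝ (Fin d) × Y) : 0 ≤ maxInput S :=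
  Real.iSup_nonneg fun _ => norm_nonneg _

theorem integrable_lossAt (hl : Measurable (Function.uncurry l))
    (hlE : ∀ u y, 0 ≤ l u y ∧ l u y ≤ E) (A : Matrix (Fin C) (Fin d) ℝ) :
    Integrable (lossAt l A) D :=
  Integrable.of_bound (measurable_lossAt hl A).aestronglyMeasurable E
    (ae_of_all _ fun z => by
      have := hlE (A.mulVec (WithLp.ofLp z.1)) z.2
      rw [Real.norm_eq_abs, abs_of_nonneg] <;> simp only [lossAt, this])

theorem gap_le_range (hl : Measurable (Function.uncurry l))
    (hlE : ∀ u y, 0 ≤ l u y ∧ l u y ≤ E) (A : Matrix (Fin C) (Fin d) ℝ)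
    (S : Fin N → EuclideanSpace ℝ (Fin d) × Y) : gap D l A S ≤ E := by
  have h1 : ∫ z, lossAt l A z ∂D ≤ E := by
    refine (integral_mono (integrable_lossAt hl hlE A) (integrable_const E)
      fun z => (hlE _ _).2).trans (by simp)
  have h2 : 0 ≤ 1 / (N : ℝ) * ∑ i, lossAt l A (S i) :=
    mul_nonneg (by positivity) (Finset.sum_nonneg fun i _ => (hlE _ _).1)
  unfold gap; linarith

/-- On the sample the truncation at b is inactive. In the expectation it matters only beyond the
sample maximum, where the error is at most `E`. -/
theorem gap_le_centeredGap_add (hl : Measurable (Function.uncurry l))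
    (hlE : ∀ u y, 0 ≤ l u y ∧ l u y ≤ E) (hE : 0 ≤ E) (A : Matrix (Fin C) (Fin d) ℝ)
    (S : Fin N → EuclideanSpace ℝ (Fin d) × Y) {b : ℝ} (hb : maxInput S ≤ b) :
    gap D l A S ≤ (∫ z, l 0 z.2 ∂D - 1 / N * ∑ k, l 0 (S k).2) +
      E * D.real {z | maxInput S < ‖z.1‖} + centeredGap D l b A S := by
  have hsum : ∑ k, lossAt l A (S k) = ∑ k, l 0 (S k).2 + ∑ k, centeredLoss l b A (S k) := by
    rw [← Finset.sum_add_distrib]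
    refine Finset.sum_congr rfl fun k _ => ?_
    rw [centeredLoss, if_pos ((norm_le_maxInput S k).trans hb)]; ring
  have hset : MeasurableSet {z : EuclideanSpace ℝ (Fin d) × Y | maxInput S < ‖z.1‖} :=
    measurableSet_lt measurable_const (by fun_prop)
  have hint0 : Integrable (fun z : EuclideanSpace ℝ (Fin d) × Y => l 0 z.2) D := by
    refine Integrable.of_bound (hl.comp (measurable_const.prodMk
      measurable_snd)).aestronglyMeasurable E (ae_of_all _ fun z => ?_)
    have := hlE 0 z.2
    rw [Real.norm_eq_abs, abs_of_nonneg] <;> simp only [this]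
  have hintc : Integrable (centeredLoss l b A) D :=
    Integrable.of_bound (measurable_centeredLoss hl b A).aestronglyMeasurable E
      (ae_of_all _ fun z => abs_centeredLoss_le_range hlE hE b A z)
  have hinti : Integrable ({z : EuclideanSpace ℝ (Fin d) × Y |
      maxInput S < ‖z.1‖}.indicator fun _ => E) D := (integrable_const E).indicator hset
  have hle : ∫ z, lossAt l A z ∂D ≤ ∫ z, l 0 z.2 ∂D +
      E * D.real {z | maxInput S < ‖z.1‖} + ∫ z, centeredLoss l b A z ∂D := by
    have h1 : E * D.real {z : EuclideanSpace ℝ (Fin d) × Y | maxInput S < ‖z.1‖} =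
        ∫ z, {z : EuclideanSpace ℝ (Fin d) × Y | maxInput S < ‖z.1‖}.indicator (fun _ => E) z ∂D := by
      rw [integral_indicator_const _ hset, smul_eq_mul, mul_comm]
    rw [h1, ← integral_add' hint0 hinti, ← integral_add' (hint0.add hinti) hintc]
    refine integral_mono (integrable_lossAt hl hlE A) ((hint0.add hinti).add hintc) fun z => ?_
    have e1 := hlE (A.mulVec (WithLp.ofLp z.1)) z.2
    have e2 := hlE 0 z.2
    simp only [Pi.add_apply, Set.indicator_apply, Set.mem_ofPred_eq, centeredLoss, lossAt]
    split_ifs with h3 h4 h4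
    · linarith
    · linarith
    · linarith
    · exact absurd (lt_of_le_of_lt hb (not_le.mp h4)) h3
  unfold gap centeredGap
  rw [hsum, mul_add]
  linarith

theorem centeredGap_le_two_mul (hN : 0 < N) {b t : ℝ} {A : Matrix (Fin C) (Fin d) ℝ}
    (h : ∀ z, |centeredLoss l b A z| ≤ t)
    (S : Fin N → EuclideanSpace ℝ (Fin d) × Y) : centeredGap D l b A S ≤ 2 * t := by
  have hN' : (0 : ℝ) < N := by exact_mod_cast hN
  have h1 : ∫ z, centeredLoss l b A z ∂D ≤ t := by
    have := norm_integral_le_of_norm_le_const (μ := D) (C := t)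
      (f := centeredLoss l b A) (ae_of_all _ h)
    rw [probReal_univ, mul_one] at this
    exact (le_abs_self _).trans this
  have h2 : -t ≤ 1 / N * ∑ k, centeredLoss l b A (S k) := by
    rw [one_div, inv_mul_eq_div, le_div_iff₀ hN', mul_comm]
    have := Finset.card_nsmul_le_sum Finset.univ (fun k => centeredLoss l b A (S k)) (-t)
      fun k _ => (abs_le.mp (h (S k))).1
    simpa using this
  unfold centeredGap; linarith

end Reduction

end LinNet

/-! ### The good event and its probability. -/

namespace LinNet

/-- The events on which the generalization bound holds. -/
def IsGoodSample {C d N : ℕ} {Y : Type*} [MeasurableSpace Y]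
    (D : Measure (EuclideanSpace ℝ (Fin d) × Y)) (l : (Fin C → ℝ) → Y → ℝ) (E lip δ : ℝ) (J : ℕ)
    (S : Fin N → EuclideanSpace ℝ (Fin d) × Y) : Prop :=
  D.real {z | maxInput S < ‖z.1‖} ≤ Real.log (4 / δ) / N ∧
  ∫ z, l 0 z.2 ∂D - 1 / N * ∑ k, l 0 (S k).2 ≤ 4 * E * Real.sqrt (Real.log (4 / δ) / N) ∧
  -- Small t: no low-rank part, hence nothing to round and the trivial grid n = 1. Range and radius
  -- shrink with the scale 2^(-j).
  (0 < lip → ∀ i₁ i₂ j : ℕ, ∀ A ∈ lowRankAdd C d 0 (2 * (1 / 2) ^ j / (lip * (2 ^ i₁ / 2 ^ i₂)))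
      (2 * (1 / 2) ^ j * Real.sqrt d / (lip * (2 ^ i₁ / 2 ^ i₂))),
    (∀ z, |centeredLoss l (2 ^ i₁ / 2 ^ i₂) A z| ≤ min (2 * (1 / 2) ^ j) E) →
    centeredGap D l (2 ^ i₁ / 2 ^ i₂) A S ≤ devBound C d 0 1 J N (min (2 * (1 / 2) ^ j) E)
      (2 * (1 / 2) ^ j * Real.sqrt d) (share δ J i₁ i₂ j 0)) ∧
  -- Large t: the grid keeps the rounding error below 1/(N 2^J), which E ≥ 1/N turns into E/2^J.
  (0 < lip → 1 / N ≤ E → ∀ i₁ i₂ j r : ℕ, ∀ A ∈ lowRankAdd C d r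
      (2 * 2 ^ j / (lip * (2 ^ i₁ / 2 ^ i₂)))
      (2 * Real.sqrt (r * d) / (lip * (2 ^ i₁ / 2 ^ i₂))),
    (∀ z, |centeredLoss l (2 ^ i₁ / 2 ^ i₂) A z| ≤ E) →
    centeredGap D l (2 ^ i₁ / 2 ^ i₂) A S ≤ devBound C d r (4 * r * d * 2 ^ j * 2 ^ J * N + 1)
      J N E (2 * Real.sqrt (r * d)) (share δ J i₁ i₂ j r))

/-- Each of the four clauses fails with probability at most δ/4. -/
theorem measure_not_isGoodSample_le {C d N : ℕ} {Y : Type*} [MeasurableSpace Y]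
    (D : Measure (EuclideanSpace ℝ (Fin d) × Y)) [IsProbabilityMeasure D]
    {l : (Fin C → ℝ) → Y → ℝ} (hl : Measurable (Function.uncurry l)) {E : ℝ} (hE : 0 < E)
    (hlE : ∀ u y, 0 ≤ l u y ∧ l u y ≤ E) {lip : ℝ}
    (hlip : ∀ u v y, |l u y - l v y| ≤ lip * ‖u - v‖) (hN : 0 < N) {δ : ℝ} (hδ : 0 < δ)
    (hδ1 : δ < 1) {J : ℕ} (hJ : Real.sqrt N ≤ 2 ^ J) :
    Measure.pi (fun _ : Fin N => D) {S | ¬ IsGoodSample D l E lip δ J S} ≤ ENNReal.ofReal δ := by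
  have hN' : (0 : ℝ) < N := by exact_mod_cast hN
  set μ := Measure.pi (fun _ : Fin N => D) with hμ
  have hlog : 0 ≤ Real.log (4 / δ) :=
    Real.log_nonneg (by rw [le_div_iff₀ hδ]; linarith)
  have h1 := measure_tail_beyond_max_le D (N := N)
    (φ := fun z : EuclideanSpace ℝ (Fin d) × Y => ‖z.1‖) (by fun_prop)
    (u := Real.log (4 / δ) / N) (by positivity)
  rw [mul_div_cancel₀ _ hN'.ne', Real.exp_neg, Real.exp_log (by positivity), inv_div] at h1
  have h2 := measure_const_loss_deviation_le D hl hE hlE hN hδ hδ1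
  have h3 : μ {S | 0 < lip ∧ ∃ i₁ i₂ j r : ℕ, r = 0 ∧
      ∃ A ∈ lowRankAdd C d r (2 * (1 / 2) ^ j / (lip * (2 ^ i₁ / 2 ^ i₂)))
        (2 * (1 / 2) ^ j * Real.sqrt d / (lip * (2 ^ i₁ / 2 ^ i₂))),
        (∀ z, |centeredLoss l (2 ^ i₁ / 2 ^ i₂) A z| ≤ min (2 * (1 / 2) ^ j) E) ∧
        devBound C d r 1 J N (min (2 * (1 / 2) ^ j) E) (2 * (1 / 2) ^ j * Real.sqrt d)
          (share δ J i₁ i₂ j r) < centeredGap D l (2 ^ i₁ / 2 ^ i₂) A S} ≤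
      ENNReal.ofReal (δ / 4) := by
    by_cases hlip0 : 0 < lip
    · simp only [hlip0, true_and]
      exact measure_exists_class_deviation_le D hl hlip0 hlip hN hδ J hJ
        (fun j => min (2 * (1 / 2) ^ j) E) (fun j => lt_min (by positivity) hE)
        (fun j => 2 * (1 / 2) ^ j) (fun j => by positivity)
        (fun j _ => 2 * (1 / 2) ^ j * Real.sqrt d) (fun j _ => by positivity)
        (fun _ _ => 1) (fun _ _ => one_pos) (fun r => r = 0) fun j r hr => by
          have : (0 : ℝ) < min (2 * (1 / 2) ^ j) E := lt_min (by positivity) hE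
          subst hr
          simp only [Nat.cast_zero, mul_zero, zero_mul, zero_div]
          positivity
    · simp [hlip0]
  have h4 : μ {S | 0 < lip ∧ ∃ i₁ i₂ j r : ℕ, 1 / (N : ℝ) ≤ E ∧
      ∃ A ∈ lowRankAdd C d r (2 * 2 ^ j / (lip * (2 ^ i₁ / 2 ^ i₂)))
        (2 * Real.sqrt (r * d) / (lip * (2 ^ i₁ / 2 ^ i₂))),
        (∀ z, |centeredLoss l (2 ^ i₁ / 2 ^ i₂) A z| ≤ E) ∧
        devBound C d r (4 * r * d * 2 ^ j * 2 ^ J * N + 1) J N E (2 * Real.sqrt (r * d))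
          (share δ J i₁ i₂ j r) < centeredGap D l (2 ^ i₁ / 2 ^ i₂) A S} ≤
      ENNReal.ofReal (δ / 4) := by
    by_cases hlip0 : 0 < lip
    · simp only [hlip0, true_and]
      exact measure_exists_class_deviation_le D hl hlip0 hlip hN hδ J hJ
        (fun _ => E) (fun _ => hE) (fun j => 2 * 2 ^ j) (fun j => by positivity)
        (fun _ r => 2 * Real.sqrt (r * d)) (fun _ _ => by positivity)
        (fun j r => 4 * r * d * 2 ^ j * 2 ^ J * N + 1) (fun _ _ => Nat.succ_pos _)
        (fun _ => 1 / (N : ℝ) ≤ E) fun j r hE' => by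
          refine le_trans ?_ (div_le_div_of_nonneg_right hE' (by positivity))
          rw [div_div, div_le_div_iff₀ (by positivity) (by positivity)]
          push_cast
          have : (0 : ℝ) ≤ 4 * r * d * 2 ^ j * 2 ^ J * N := by positivity
          linarith
    · simp [hlip0]
  have hsum : ENNReal.ofReal δ = ENNReal.ofReal (δ / 4) + ENNReal.ofReal (δ / 4) +
      ENNReal.ofReal (δ / 4) + ENNReal.ofReal (δ / 4) := by
    rw [← ENNReal.ofReal_add (by positivity) (by positivity),
      ← ENNReal.ofReal_add (by positivity) (by positivity),
      ← ENNReal.ofReal_add (by positivity) (by positivity)]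
    congr 1; ring
  rw [hsum]
  refine le_trans (measure_mono ?_) ((measure_union_le _ _).trans (add_le_add
    ((measure_union_le _ _).trans (add_le_add
      ((measure_union_le _ _).trans (add_le_add h1 h2)) h3)) h4))
  intro S hS
  by_contra hno
  simp only [Set.mem_union, Set.mem_ofPred_eq, not_or] at hno
  obtain ⟨⟨⟨n1, n2⟩, n3⟩, n4⟩ := hno
  refine hS ⟨not_lt.mp n1, not_lt.mp n2, fun hlip0 i₁ i₂ j A hA hAe => ?_,
    fun hlip0 hE' i₁ i₂ j r A hA hAe => ?_⟩
  · by_contra hlt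
    exact n3 ⟨hlip0, i₁, i₂, j, 0, rfl, A, hA, hAe, not_le.mp hlt⟩
  · by_contra hlt
    exact n4 ⟨hlip0, i₁, i₂, j, r, hE', A, hA, hAe, not_le.mp hlt⟩

/-- Numerical bounds by powers of a logarithm that dominates all parameters. -/
theorem sqrt_log_inv_share_le {Λ δ : ℝ} (hΛ : 3 ≤ Λ) (hδ : 0 < δ) (hδ1 : δ < 1)
    {J i₁ i₂ j : ℕ} (r : ℕ) (hJ : (J : ℝ) + 1 ≤ Λ) (h₁ : (2 : ℝ) ^ i₁ ≤ Λ ^ 2)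
    (h₂ : (2 : ℝ) ^ i₂ ≤ Λ ^ 4) (hj : (2 : ℝ) ^ j ≤ Λ ^ 4) :
    Real.sqrt (Real.log (1 / share δ J i₁ i₂ j r)) ≤
      Real.sqrt (Real.log (4 / δ)) + 5 * Real.log Λ * Real.sqrt (r + 1) := by
  have hℓ : 1 ≤ Real.log Λ := by
    rw [Real.le_log_iff_exp_le (by linarith)]
    have := Real.exp_one_lt_d9
    linarith
  have hshare : 1 / share δ J i₁ i₂ j r =
      (4 / δ) * (2 * (J + 1) * (2 ^ i₁ * 2 ^ i₂ * 2 ^ j * 16)) * 2 ^ r := by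
    unfold share
    rw [div_pow, one_pow]
    field_simp
    ring
  have hbig : 2 * ((J : ℝ) + 1) * (2 ^ i₁ * 2 ^ i₂ * 2 ^ j * 16) ≤ Λ ^ 15 := by
    have h0 : 0 ≤ Λ := by linarith
    calc 2 * ((J : ℝ) + 1) * (2 ^ i₁ * 2 ^ i₂ * 2 ^ j * 16)
        ≤ Λ * Λ * (Λ ^ 2 * Λ ^ 4 * Λ ^ 4 * Λ ^ 3) := by
          gcongr
          · linarith
          · nlinarith [pow_le_pow_left₀ (by norm_num : (0 : ℝ) ≤ 3) hΛ 3]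
      _ = Λ ^ 15 := by ring
  have hlog : Real.log (1 / share δ J i₁ i₂ j r) ≤
      Real.log (4 / δ) + (5 * Real.log Λ * Real.sqrt (r + 1)) ^ 2 := by
    rw [hshare, Real.log_mul (by positivity) (by positivity),
      Real.log_mul (by positivity) (by positivity), Real.log_pow]
    have h1 := Real.log_le_log (by positivity) hbig
    rw [Real.log_pow] at h1
    push_cast at h1
    have h2 : Real.log 2 ≤ 1 := by have := Real.log_two_lt_d9; linarith
    -- The weight 2^(-r) in the union bound costs r log 2, the source of the √(r + 1).
    have h3 : (r : ℝ) * Real.log 2 ≤ r := by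
      have : (0 : ℝ) ≤ r := Nat.cast_nonneg r
      nlinarith
    rw [mul_pow, Real.sq_sqrt (by positivity)]
    have hr : (0 : ℝ) ≤ r := Nat.cast_nonneg r
    have h4 : Real.log Λ ≤ Real.log Λ ^ 2 := by nlinarith
    have h5 : (1 : ℝ) ≤ Real.log Λ ^ 2 := by nlinarith
    have h6 : (r : ℝ) ≤ Real.log Λ ^ 2 * r := by nlinarith
    nlinarith
  refine (Real.sqrt_le_sqrt hlog).trans ((sqrt_add_le _ _).trans (add_le_add le_rfl ?_))
  rw [Real.sqrt_sq (by positivity)]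

/-- Two logarithms suffice: one for the number of levels, one for the root of the logarithm of the
alphabet. -/
theorem devBound_le {C d r n J N : ℕ} {e ρ δ δ' Λ : ℝ} (hΛ : 3 ≤ Λ) (he : 0 ≤ e) (hρ : 0 ≤ ρ)
    (hJ : (J : ℝ) + 1 ≤ 4 * Real.log Λ) (hC : (4 : ℝ) * N * C + 1 ≤ Λ ^ 4)
    (hn : (2 : ℝ) * n + 1 ≤ Λ ^ 16)
    (hδ' : Real.sqrt (Real.log (1 / δ')) ≤
      Real.sqrt (Real.log (4 / δ)) + 5 * Real.log Λ * Real.sqrt (r + 1)) :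
    devBound C d r n J N e ρ δ' ≤ (80 * e * Real.sqrt (Real.log (4 / δ)) +
      Real.log Λ ^ 2 * (e * (320 * Real.sqrt (r * (C + d)) + 400 * Real.sqrt (r + 1) + 168) +
        640 * ρ)) / Real.sqrt N := by
  have hℓ : 1 ≤ Real.log Λ := by
    rw [Real.le_log_iff_exp_le (by linarith)]
    have := Real.exp_one_lt_d9
    linarith
  set ℓ := Real.log Λ
  have hℓ2 : ℓ ≤ ℓ ^ 2 := by nlinarith
  have hh : Real.sqrt (Real.log (4 * N * C + 1)) ≤ 2 * ℓ := by
    rw [Real.sqrt_le_left (by positivity)]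
    have := Real.log_le_log (by positivity) hC
    rw [Real.log_pow] at this
    push_cast at this
    nlinarith
  have hP : Real.sqrt (r * (C + d) * Real.log (2 * n + 1)) ≤ 4 * ℓ * Real.sqrt (r * (C + d)) := by
    rw [Real.sqrt_mul (by positivity), mul_comm]
    gcongr
    rw [Real.sqrt_le_left (by positivity)]
    have := Real.log_le_log (by positivity) hn
    rw [Real.log_pow] at this
    push_cast at this
    nlinarith
  unfold devBound
  refine div_le_div_of_nonneg_right ?_ (Real.sqrt_nonneg _)
  set sP := Real.sqrt (r * (C + d))
  set sr := Real.sqrt ((r : ℝ) + 1)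
  set sD := Real.sqrt (Real.log (4 / δ))
  have hsP : 0 ≤ sP := Real.sqrt_nonneg _
  have hsr : 0 ≤ sr := Real.sqrt_nonneg _
  have h1 : 80 * e * (Real.sqrt (r * (C + d) * Real.log (2 * n + 1)) +
      Real.sqrt (Real.log (4 * N * C + 1)) + Real.sqrt (Real.log (1 / δ'))) ≤
      80 * e * (4 * ℓ * sP + 2 * ℓ + (sD + 5 * ℓ * sr)) := by gcongr
  have h2 : 80 * ((J : ℝ) + 1) * ρ * Real.sqrt (Real.log (4 * N * C + 1)) ≤
      80 * (4 * ℓ) * ρ * (2 * ℓ) := by gcongr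
  have h3 : e * ℓ * (320 * sP + 400 * sr + 160) ≤ e * ℓ ^ 2 * (320 * sP + 400 * sr + 160) := by
    gcongr
  have h4 : 8 * e ≤ ℓ ^ 2 * (8 * e) := by nlinarith
  linarith

end LinNet

/-! ### Deterministic bounds on the good event. -/

namespace LinNet

section

variable {C d N : ℕ} {Y : Type*} [MeasurableSpace Y]
  {D : Measure (EuclideanSpace ℝ (Fin d) × Y)}
  {l : (Fin C → ℝ) → Y → ℝ} {E lip δ : ℝ} {J : ℕ} {S : Fin N → EuclideanSpace ℝ (Fin d) × Y}

theorem IsGoodSample.gap_le [IsProbabilityMeasure D] (hS : IsGoodSample D l E lip δ J S)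
    (hl : Measurable (Function.uncurry l)) (hlE : ∀ u y, 0 ≤ l u y ∧ l u y ≤ E) (hE : 0 ≤ E)
    (A : Matrix (Fin C) (Fin d) ℝ) {b : ℝ} (hb : maxInput S ≤ b) :
    gap D l A S ≤ 5 * E * Real.sqrt (Real.log (4 / δ) / N) + centeredGap D l b A S := by
  have h1 := gap_le_centeredGap_add (D := D) hl hlE hE A S hb
  have h2 : D.real {z | maxInput S < ‖z.1‖} ≤ Real.sqrt (Real.log (4 / δ) / N) := by
    refine Real.le_sqrt_of_sq_le (le_trans ?_ hS.1)
    have h0 := measureReal_nonneg (μ := D) (s := {z | maxInput S < ‖z.1‖})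
    have h1 := measureReal_le_one (μ := D) (s := {z | maxInput S < ‖z.1‖})
    nlinarith
  have h3 := hS.2.1
  have h4 := mul_le_mul_of_nonneg_left h2 hE
  linarith

theorem pos_dims_of_specNorm_pos {A : Matrix (Fin C) (Fin d) ℝ} (hA : 0 < specNorm A) :
    1 ≤ C ∧ 1 ≤ d := by
  rcases Nat.eq_zero_or_pos C with rfl | hC
  · rw [show A = 0 from by ext i; exact i.elim0] at hA
    simp [specNorm] at hA
  rcases Nat.eq_zero_or_pos d with rfl | hd
  · rw [show A = 0 from by ext i j; exact j.elim0] at hA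
    simp [specNorm] at hA
  exact ⟨hC, hd⟩

theorem four_mul_add_one_le_pow {x y Λ : ℝ} (hx : 0 ≤ x) (hy : 0 ≤ y) (h : x + y ≤ Λ)
    (hΛ : 3 ≤ Λ) : 4 * x * y + 1 ≤ Λ ^ 4 := by
  have h1 : (x + y) ^ 2 ≤ Λ ^ 2 := by gcongr
  have h2 : Λ ^ 4 = Λ ^ 2 * Λ ^ 2 := by ring
  have h3 : 9 ≤ Λ ^ 2 := by nlinarith
  nlinarith [sq_nonneg (x - y)]

theorem two_mul_mul_mul_add_one_le_pow {x y z Λ : ℝ} (hy : 0 ≤ y) (hz : 0 ≤ z)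
    (hx' : x ≤ Λ) (hy' : y ≤ Λ) (hz' : z ≤ Λ) (hΛ : 3 ≤ Λ) : 2 * (x * y * z) + 1 ≤ Λ ^ 4 := by
  have hΛ0 : 0 ≤ Λ := by linarith
  have h1 : x * y * z ≤ Λ * Λ * Λ := by gcongr
  have h2 : (3 : ℝ) ^ 3 ≤ Λ ^ 3 := by gcongr
  have h3 : Λ ^ 4 = Λ * Λ ^ 3 := by ring
  have h4 : Λ * Λ * Λ = Λ ^ 3 := by ring
  nlinarith

theorem two_mul_add_one_le_sq {x Λ : ℝ} (hx : x ≤ Λ) (hΛ : 3 ≤ Λ) : 2 * x + 1 ≤ Λ ^ 2 := by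
  nlinarith

theorem sqrt_rank_terms_le {r C d : ℝ} (hr : 1 ≤ r) (hC : 1 ≤ C) (hd : 1 ≤ d) :
    Real.sqrt (r + 1) ≤ Real.sqrt (r * (C + d)) ∧ Real.sqrt (r * d) ≤ Real.sqrt (r * (C + d)) ∧
      1 ≤ Real.sqrt (r * (C + d)) :=
  ⟨Real.sqrt_le_sqrt (by nlinarith), Real.sqrt_le_sqrt (by nlinarith),
    Real.one_le_sqrt.mpr (by nlinarith)⟩

theorem two_mul_card_add_one_le_pow {r d N s u Λ : ℝ} (hd0 : 0 ≤ d) (hN0 : 0 ≤ N)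
    (hs0 : 0 ≤ s) (hu0 : 0 ≤ u) (hr : r ≤ Λ) (hd : d ≤ Λ) (hN : N ≤ Λ) (hs : s ≤ Λ ^ 4)
    (hu : u ≤ 2 * N) (hΛ : 3 ≤ Λ) : 2 * (4 * r * d * s * u * N + 1) + 1 ≤ Λ ^ 16 := by
  have hΛ0 : 0 ≤ Λ := by linarith
  have h1 : 4 * r * d * s * u * N ≤ 4 * Λ * Λ * Λ ^ 4 * (2 * Λ) * Λ := by
    gcongr; linarith
  have h2 : 4 * Λ * Λ * Λ ^ 4 * (2 * Λ) * Λ = 8 * Λ ^ 8 := by ring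
  have h3 : (3 : ℝ) ^ 8 ≤ Λ ^ 8 := by gcongr
  have h4 : Λ ^ 16 = Λ ^ 8 * Λ ^ 8 := by ring
  nlinarith

/-- The depth must make 2^J at least √N, yet enter the final bound only as a logarithm. -/
theorem exists_cover_depth {Λ : ℝ} (hN : 0 < N) (hΛ : (N : ℝ) + 2 ≤ Λ) :
    Real.sqrt N ≤ 2 ^ Nat.clog 2 N ∧ (2 : ℝ) ^ Nat.clog 2 N ≤ 2 * N ∧
      (Nat.clog 2 N : ℝ) + 1 ≤ Λ ∧ (Nat.clog 2 N : ℝ) + 1 ≤ 4 * Real.log Λ := by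
  have hN' : (1 : ℝ) ≤ N := by exact_mod_cast hN
  have hJ1 : (N : ℝ) ≤ 2 ^ Nat.clog 2 N := by
    exact_mod_cast Nat.le_pow_clog one_lt_two N
  have hJ2 : (2 : ℝ) ^ Nat.clog 2 N ≤ 2 * N := by
    rcases Nat.lt_or_ge 1 N with h | h
    · have h1 := Nat.pow_pred_clog_lt_self one_lt_two h
      have h2 : 0 < Nat.clog 2 N := Nat.clog_pos one_lt_two h
      obtain ⟨m, hm⟩ := Nat.exists_eq_succ_of_ne_zero h2.ne'
      rw [hm] at h1 ⊢
      simp only [Nat.pred_succ] at h1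
      have h3 : (2 : ℝ) ^ m ≤ N := by exact_mod_cast h1.le
      rw [Nat.succ_eq_add_one, pow_succ]; linarith
    · rw [Nat.clog_of_right_le_one h]; norm_num; linarith
  have hJ3 : (Nat.clog 2 N : ℝ) ≤ N := by
    exact_mod_cast Nat.clog_le_of_le_pow Nat.lt_two_pow_self.le
  refine ⟨le_trans ?_ hJ1, hJ2, by linarith, ?_⟩
  · rw [Real.sqrt_le_left (by linarith)]; nlinarith
  · have h1 := Real.log_le_log (by positivity) hJ2
    rw [Real.log_pow, Real.log_mul two_ne_zero (by positivity)] at h1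
    have h2 := Real.log_le_log (by linarith) (show (N : ℝ) ≤ Λ by linarith)
    have h3 := Real.log_two_gt_d9
    have h4 : 1 ≤ Real.log Λ := by
      rw [Real.le_log_iff_exp_le (by linarith)]
      have := Real.exp_one_lt_d9
      linarith
    have h5 : (0 : ℝ) ≤ Nat.clog 2 N := Nat.cast_nonneg _
    nlinarith

variable {A : Matrix (Fin C) (Fin d) ℝ} {Λ : ℝ}

/-- The case of a network with small margin, the class of a bounded spectral norm. -/
theorem IsGoodSample.centeredGap_le_of_le_one (hS : IsGoodSample D l E lip δ (Nat.clog 2 N) S)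
    (hlE : ∀ u y, 0 ≤ l u y ∧ l u y ≤ E) (hE : 0 < E) (hlip0 : 0 < lip)
    (hlip : ∀ u v y, |l u y - l v y| ≤ lip * ‖u - v‖) (hN : 0 < N) (hδ : 0 < δ) (hδ1 : δ < 1)
    (hΛ : Λ = 2 + N + C + d + lip + maxInput S + specNorm A)
    (hlo : 1 / (N : ℝ) < lip * maxInput S * specNorm A)
    (hhi : lip * maxInput S * specNorm A ≤ 1) :
    ∃ b, maxInput S ≤ b ∧ centeredGap D l b A S ≤
      80 * E * Real.sqrt (Real.log (4 / δ) / N) + 5000 * Real.log Λ ^ 2 *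
        (lip * maxInput S * specNorm A * Real.sqrt (d / N)) := by
  have hN' : (1 : ℝ) ≤ N := by exact_mod_cast hN
  have ha0 := specNorm_nonneg A
  have hB0 := maxInput_nonneg S
  have ht : 0 < lip * maxInput S * specNorm A := lt_trans (by positivity) hlo
  have ha : 0 < specNorm A := ha0.lt_of_ne fun h => by rw [← h] at ht; simp at ht
  have hB : 0 < maxInput S := hB0.lt_of_ne fun h => by rw [← h] at ht; simp at ht
  obtain ⟨hC, hd⟩ := pos_dims_of_specNorm_pos ha
  have hC' : (1 : ℝ) ≤ C := by exact_mod_cast hC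
  have hd' : (1 : ℝ) ≤ d := by exact_mod_cast hd
  have hΛ3 : 3 ≤ Λ := by linarith
  obtain ⟨-, -, hJ1, hJ2⟩ := exists_cover_depth (Λ := Λ) hN (by linarith)
  obtain ⟨i₁, i₂, hb1, hb2, hi₁, hi₂⟩ := exists_dyadic_near hB
  set t := lip * maxInput S * specNorm A with htdef
  obtain ⟨j, hj1, hj2⟩ := exists_nat_pow_near ((one_le_div ht).mpr hhi) (one_lt_two (α := ℝ))
  set b : ℝ := 2 ^ i₁ / 2 ^ i₂ with hbdef
  have hbpos : 0 < b := by positivity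
  have hT1 : t ≤ (1 / 2) ^ j * 1 ∧ (1 / 2) ^ j ≤ 2 * t := by
    rw [le_div_iff₀ ht] at hj1
    rw [div_lt_iff₀ ht, pow_succ] at hj2
    rw [div_pow, one_pow, mul_one, le_div_iff₀ (by positivity), div_le_iff₀ (by positivity)]
    constructor <;> nlinarith
  rw [mul_one] at hT1
  set T : ℝ := 2 * (1 / 2) ^ j with hT
  have hTpos : 0 < T := by positivity
  have hbt : lip * b * specNorm A ≤ T := by
    have : lip * b * specNorm A ≤ lip * (2 * maxInput S) * specNorm A := by gcongr
    nlinarith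
  -- With r = 0 the remainder is all of `A`, of Frobenius norm at most √d ‖A‖. The 2 in `T` pays for
  -- b ≤ 2 𝔅.
  have hmem : A ∈ lowRankAdd C d 0 (T / (lip * b)) (T * Real.sqrt d / (lip * b)) := by
    obtain ⟨U, V, hU, hV, hUV⟩ := exists_lowRank_add A (Nat.zero_le d)
    have hle : specNorm A ≤ T / (lip * b) := by
      rw [le_div_iff₀ (by positivity)]; linarith
    refine ⟨U, V, fun c k => (hU c k).trans hle, hV, hUV.trans ?_⟩
    rw [← specNorm_eq_singularValues_zero, mul_div_right_comm, mul_pow,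
      Real.sq_sqrt (by positivity), mul_comm]
    gcongr
  have hbound := (hS.2.2.1 hlip0 i₁ i₂ j A hmem fun z => le_min
    ((abs_centeredLoss_le_norm hlip0.le hlip hbpos.le A z).trans (by linarith))
    (abs_centeredLoss_le_range hlE hE.le b A z)).trans
    (devBound_le hΛ3 (le_min hTpos.le hE.le) (by positivity) hJ2 ?_ ?_
      (sqrt_log_inv_share_le hΛ3 hδ hδ1 0 hJ1 ?_ ?_ ?_))
  rotate_left
  · exact four_mul_add_one_le_pow (Nat.cast_nonneg N) (Nat.cast_nonneg C) (by linarith) hΛ3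
  · norm_num
    exact hΛ3.trans (le_self_pow₀ (by linarith) (by norm_num))
  · exact hi₁.trans (two_mul_add_one_le_sq (by linarith) hΛ3)
  -- The lower bound t > 1/N keeps 1/𝔅, and so the index i₂, under control.
  · have h1 : 1 / maxInput S ≤ N * lip * specNorm A := by
      rw [div_le_iff₀ hB]
      rw [div_lt_iff₀ (by positivity)] at hlo
      linarith
    have h2 := two_mul_mul_mul_add_one_le_pow (x := N) hlip0.le ha0 (Λ := Λ) (by linarith)
      (by linarith) (by linarith) hΛ3
    have h3 : 0 ≤ N * lip * specNorm A := by positivity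
    linarith
  · have h1 : 1 / t ≤ N := by
      rw [div_le_iff₀ ht]; rw [div_lt_iff₀ (by positivity)] at hlo; linarith
    have h2 : Λ ≤ Λ ^ 4 := le_self_pow₀ (by linarith) (by norm_num)
    linarith
  rw [← hT, ← hbdef] at hbound
  refine ⟨b, hb1, hbound.trans ?_⟩
  have hsd : 1 ≤ Real.sqrt d := Real.one_le_sqrt.mpr hd'
  have hℓ := sq_nonneg (Real.log Λ)
  rw [Real.sqrt_div' _ (Nat.cast_nonneg N), Real.sqrt_div' _ (Nat.cast_nonneg N), ← mul_div_assoc,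
    ← mul_div_assoc, ← mul_div_assoc, ← add_div]
  refine div_le_div_of_nonneg_right ?_ (Real.sqrt_nonneg _)
  -- The confidence term uses the bound E on the range, the complexity term the bound 4t.
  have e1 : min T E ≤ E := min_le_right _ _
  have e2 : min T E ≤ 4 * t := (min_le_left _ _).trans (by linarith)
  refine add_le_add (by gcongr) ?_
  refine le_trans (mul_le_mul_of_nonneg_left (c := 5000 * (t * Real.sqrt d)) ?_ hℓ)
    (le_of_eq (by ring))
  simp only [Nat.cast_zero, zero_mul, Real.sqrt_zero, mul_zero, zero_add, Real.sqrt_one]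
  have e3 : T * Real.sqrt d ≤ 4 * t * Real.sqrt d := by
    gcongr; linarith
  have e4 : 4 * t * 1 ≤ 4 * t * Real.sqrt d := by gcongr
  linarith

/-- The case of a network with large margin, the class of approximate low rank. -/
theorem IsGoodSample.centeredGap_le_of_one_le (hS : IsGoodSample D l E lip δ (Nat.clog 2 N) S)
    (hlE : ∀ u y, 0 ≤ l u y ∧ l u y ≤ E) (hNE : 1 / (N : ℝ) ≤ E) (hlip0 : 0 < lip)
    (hN : 0 < N) (hδ : 0 < δ) (hδ1 : δ < 1)
    (hΛ : Λ = 2 + N + C + d + lip + maxInput S + specNorm A)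
    (ht1 : 1 ≤ lip * maxInput S * specNorm A) {r : ℕ} (hr : 1 ≤ r) (hrd : r ≤ d)
    (hσ : lip * maxInput S * (Matrix.toEuclideanLin A).singularValues r ≤ Real.sqrt r) :
    ∃ b, maxInput S ≤ b ∧ centeredGap D l b A S ≤
      80 * E * Real.sqrt (Real.log (4 / δ) / N) + 2000 * (E + 1) * Real.log Λ ^ 2 *
        Real.sqrt (r * (C + d) / N) := by
  have hN' : (1 : ℝ) ≤ N := by exact_mod_cast hN
  have hE : 0 < E := lt_of_lt_of_le (by positivity) hNE
  have ha0 := specNorm_nonneg A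
  have hB0 := maxInput_nonneg S
  have ht : 0 < lip * maxInput S * specNorm A := by linarith
  have ha : 0 < specNorm A := ha0.lt_of_ne fun h => by rw [← h] at ht; simp at ht
  have hB : 0 < maxInput S := hB0.lt_of_ne fun h => by rw [← h] at ht; simp at ht
  obtain ⟨hC, hd⟩ := pos_dims_of_specNorm_pos ha
  have hC' : (1 : ℝ) ≤ C := by exact_mod_cast hC
  have hd' : (1 : ℝ) ≤ d := by exact_mod_cast hd
  have hr' : (1 : ℝ) ≤ r := by exact_mod_cast hr
  have hrd' : (r : ℝ) ≤ d := by exact_mod_cast hrd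
  have hΛ3 : 3 ≤ Λ := by linarith
  have hΛ0 : 0 ≤ Λ := by linarith
  obtain ⟨-, hJ0, hJ1, hJ2⟩ := exists_cover_depth (Λ := Λ) hN (by linarith)
  obtain ⟨i₁, i₂, hb1, hb2, hi₁, hi₂⟩ := exists_dyadic_near hB
  obtain ⟨j, hj1, hj2⟩ := exists_two_pow_near ht1
  set b : ℝ := 2 ^ i₁ / 2 ^ i₂ with hbdef
  have hbpos : 0 < b := by positivity
  have hbt : lip * b * specNorm A ≤ 2 * 2 ^ j := by
    have : lip * b * specNorm A ≤ lip * (2 * maxInput S) * specNorm A := by gcongr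
    nlinarith
  have hj : (2 : ℝ) ^ j ≤ Λ ^ 4 := by
    have := two_mul_mul_mul_add_one_le_pow (x := lip) hB0 ha0 (Λ := Λ) (by linarith)
      (by linarith) (by linarith) hΛ3
    linarith
  have hmem : A ∈ lowRankAdd C d r (2 * 2 ^ j / (lip * b))
      (2 * Real.sqrt (r * d) / (lip * b)) := by
    obtain ⟨U, V, hU, hV, hUV⟩ := exists_lowRank_add A hrd
    have hle : specNorm A ≤ 2 * 2 ^ j / (lip * b) := by
      rw [le_div_iff₀ (by positivity)]; linarith
    refine ⟨U, V, fun c k => (hU c k).trans hle, hV, hUV.trans ?_⟩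
    have hσ0 := LinearMap.singularValues_nonneg (Matrix.toEuclideanLin A) r
    -- As b ≤ 2𝔅, the choice of r gives a remainder of Frobenius norm at most √d σ_r ≤ 2√(rd)/(λb).
    have h1 : (Matrix.toEuclideanLin A).singularValues r ≤ 2 * Real.sqrt r / (lip * b) := by
      rw [le_div_iff₀ (by positivity)]
      calc _ ≤ (Matrix.toEuclideanLin A).singularValues r * (lip * (2 * maxInput S)) := by gcongr
        _ ≤ _ := by linarith
    calc _ ≤ (d : ℝ) * (2 * Real.sqrt r / (lip * b)) ^ 2 := by gcongr
      _ = _ := by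
        rw [div_pow, div_pow, mul_pow, mul_pow 2 (Real.sqrt (r * d)),
          Real.sq_sqrt (Nat.cast_nonneg r), Real.sq_sqrt (by positivity)]
        ring
  have hbound := (hS.2.2.2 hlip0 hNE i₁ i₂ j r A hmem
    (abs_centeredLoss_le_range hlE hE.le b A)).trans
    (devBound_le hΛ3 hE.le (by positivity) hJ2 ?_ ?_
      (sqrt_log_inv_share_le hΛ3 hδ hδ1 r hJ1 ?_ ?_ hj))
  rotate_left
  · exact four_mul_add_one_le_pow (Nat.cast_nonneg N) (Nat.cast_nonneg C) (by linarith) hΛ3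
  · push_cast
    exact two_mul_card_add_one_le_pow (by positivity) (by positivity) (by positivity)
      (by positivity) (by linarith) (by linarith) (by linarith) hj hJ0 hΛ3
  · exact hi₁.trans (two_mul_add_one_le_sq (by linarith) hΛ3)
  · have h1 : 1 / maxInput S ≤ 1 * lip * specNorm A := by
      rw [div_le_iff₀ hB]; linarith
    have h2 := two_mul_mul_mul_add_one_le_pow (x := 1) hlip0.le ha0 (Λ := Λ) (by linarith)
      (by linarith) (by linarith) hΛ3
    have h3 : 0 ≤ 1 * lip * specNorm A := by positivity
    linarith
  refine ⟨b, hb1, hbound.trans ?_⟩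
  have hℓ := sq_nonneg (Real.log Λ)
  rw [Real.sqrt_div' _ (Nat.cast_nonneg N), Real.sqrt_div' _ (Nat.cast_nonneg N), ← mul_div_assoc,
    ← mul_div_assoc, ← add_div]
  refine div_le_div_of_nonneg_right (add_le_add le_rfl ?_) (Real.sqrt_nonneg _)
  obtain ⟨e1, e2, e3⟩ := sqrt_rank_terms_le hr' hC' hd'
  set s := Real.sqrt ((r : ℝ) * (C + d))
  rw [mul_comm (2000 * (E + 1)), mul_assoc]
  refine mul_le_mul_of_nonneg_left ?_ hℓ
  have e4 : E * (320 * s + 400 * Real.sqrt ((r : ℝ) + 1) + 168) ≤ E * (888 * s) :=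
    mul_le_mul_of_nonneg_left (by linarith) hE.le
  have e5 : 0 ≤ E * s := by positivity
  linarith

end

end LinNet

/-! ### Assembling the regimes. -/

namespace LinNet

theorem IsGoodSample.gap_netMatrix_le {L : ℕ} (hL : 0 < L) {w : ℕ → ℕ} {q : Fin L → ℝ}
    (hq : ∀ ℓ, 0 ≤ q ℓ ∧ q ℓ ≤ 1) {Y : Type*} [MeasurableSpace Y] {N : ℕ}
    {D : Measure (EuclideanSpace ℝ (Fin (w 0)) × Y)} [IsProbabilityMeasure D]
    {l : (Fin (w L) → ℝ) → Y → ℝ} {E lip δ : ℝ} {S : Fin N → EuclideanSpace ℝ (Fin (w 0)) × Y}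
    (hS : IsGoodSample D l E lip δ (Nat.clog 2 N) S)
    (hl : Measurable (Function.uncurry l)) (hlE : ∀ u y, 0 ≤ l u y ∧ l u y ≤ E) (hE : 0 < E)
    (hlip0 : 0 ≤ lip) (hlip : ∀ u v y, |l u y - l v y| ≤ lip * ‖u - v‖) (hN : 0 < N)
    (hδ : 0 < δ) (hδ1 : δ < 1) (B : Factors L w) {Λ : ℝ}
    (hΛ : Λ = 2 + N + w L + w 0 + lip + maxInput S + specNorm (netMatrix B)) :
    gap D l (netMatrix B) S ≤ 10000 * E * Real.sqrt (Real.log (4 / δ) / N) +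
      10000 * (E + 1) * Real.log Λ ^ 2 *
        Real.sqrt (complexity q B (lip * maxInput S) * ((w L : ℝ) + w 0) / N) := by
  have hN' : (1 : ℝ) ≤ N := by exact_mod_cast hN
  set A := netMatrix B
  have ha0 := specNorm_nonneg A
  have hB0 := maxInput_nonneg S
  have hC0 : (0 : ℝ) ≤ w L := Nat.cast_nonneg _
  have hd0 : (0 : ℝ) ≤ w 0 := Nat.cast_nonneg _
  have hG0 := complexity_nonneg hL q B (x := lip * maxInput S) (by positivity)
  have hℓ : 1 ≤ Real.log Λ ^ 2 := by
    refine one_le_pow₀ ?_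
    rw [Real.le_log_iff_exp_le (by linarith)]
    have := Real.exp_one_lt_d9
    linarith
  set sD := Real.sqrt (Real.log (4 / δ) / N)
  have hsD : 0 ≤ sD := Real.sqrt_nonneg _
  set G := complexity q B (lip * maxInput S) with hG
  set X := Real.sqrt (G * ((w L : ℝ) + w 0) / N) with hX
  have hX0 : 0 ≤ X := Real.sqrt_nonneg _
  have key : ∀ v, v ≤ 5000 * (E + 1) * X → v ≤ 10000 * (E + 1) * Real.log Λ ^ 2 * X := by
    intro v hv
    have h1 : 0 ≤ (E + 1) * X := by positivity
    have h2 : (E + 1) * X * 1 ≤ (E + 1) * X * Real.log Λ ^ 2 := by gcongr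
    linarith
  have hED : 0 ≤ E * sD := by positivity
  set t := lip * maxInput S * specNorm A with ht
  have ht0 : 0 ≤ t := by positivity
  have hsmall : t ≤ 1 → t * Real.sqrt (((w L : ℝ) + w 0) / N) ≤ X := by
    intro ht1
    rcases ht0.eq_or_lt with h0 | h0
    · rw [← h0, zero_mul]; exact hX0
    have ha : 0 < specNorm A := ha0.lt_of_ne fun h => by rw [ht, ← h] at h0; simp at h0
    have hx : 0 < lip * maxInput S :=
      lt_of_le_of_ne (by positivity) fun h => by rw [ht, ← h] at h0; simp at h0
    have h1 : t ≤ G := le_complexity_of_le_one hL hq B hx ha ht1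
    rw [hX, mul_div_assoc, Real.sqrt_mul hG0]
    -- From t ≤ 1 and t ≤ G follows t² ≤ G.
    refine mul_le_mul_of_nonneg_right (Real.le_sqrt_of_sq_le ?_) (Real.sqrt_nonneg _)
    nlinarith
  -- For t ≤ 1/N the centered gap is at most 2t, and t² ≤ G/N makes this small enough without any
  -- class.
  rcases le_or_gt t (1 / N) with hlo | hlo
  · refine (hS.gap_le hl hlE hE.le A le_rfl).trans ?_
    refine add_le_add (by linarith) (key _ ?_)
    have h1 := centeredGap_le_two_mul (D := D) hN
      (fun z => abs_centeredLoss_le_norm hlip0 hlip hB0 A z) S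
    have h2 : t ≤ X := by
      rcases ht0.eq_or_lt with h0 | h0
      · rw [← h0]; exact hX0
      have ha : 0 < specNorm A := ha0.lt_of_ne fun h => by rw [ht, ← h] at h0; simp at h0
      have hx : 0 < lip * maxInput S :=
        lt_of_le_of_ne (by positivity) fun h => by rw [ht, ← h] at h0; simp at h0
      have ht1 : t ≤ 1 := hlo.trans ((div_le_one (by positivity)).mpr hN')
      have hG1 : t ≤ G := le_complexity_of_le_one hL hq B hx ha ht1
      obtain ⟨-, hd⟩ := pos_dims_of_specNorm_pos ha
      have hd' : (1 : ℝ) ≤ w 0 := by exact_mod_cast hd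
      refine Real.le_sqrt_of_sq_le ?_
      calc t ^ 2 = t * t := sq t
        _ ≤ G * (1 / N) := by gcongr
        _ ≤ G * (((w L : ℝ) + w 0) / N) := by gcongr; linarith
        _ = _ := by ring
    have h3 : 0 ≤ E * X := by positivity
    have h4 : lip * (specNorm A * maxInput S) = t := by rw [ht]; ring
    rw [h4] at h1
    linarith
  have htpos : 0 < t := lt_trans (by positivity) hlo
  have ha : 0 < specNorm A := ha0.lt_of_ne fun h => by rw [ht, ← h] at htpos; simp at htpos
  have hx : 0 < lip * maxInput S :=
    lt_of_le_of_ne (by positivity) fun h => by rw [ht, ← h] at htpos; simp at htpos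
  have hlippos : 0 < lip := hlip0.lt_of_ne fun h => by rw [← h, zero_mul] at hx; exact hx.false
  rcases le_or_gt t 1 with hhi | hhi
  · obtain ⟨b, hb, h1⟩ := hS.centeredGap_le_of_le_one hlE hE hlippos hlip hN hδ hδ1 hΛ hlo hhi
    refine (hS.gap_le hl hlE hE.le A hb).trans ?_
    have h2 : t * Real.sqrt ((w 0 : ℝ) / N) ≤ t * Real.sqrt (((w L : ℝ) + w 0) / N) := by
      gcongr; linarith
    have h3 : 5000 * Real.log Λ ^ 2 * (t * Real.sqrt ((w 0 : ℝ) / N)) ≤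
        5000 * Real.log Λ ^ 2 * X := by
      gcongr; exact h2.trans (hsmall hhi)
    have h4 : 0 ≤ E * (Real.log Λ ^ 2 * X) := by positivity
    have h5 : 0 ≤ Real.log Λ ^ 2 * X := by positivity
    linarith
  · obtain ⟨r, hr1, hrd, hrG, hσ⟩ := exists_rank_index hL hq B hx ha hhi.le
    obtain ⟨hC, hd⟩ := pos_dims_of_specNorm_pos ha
    have hd' : (1 : ℝ) ≤ w 0 := by exact_mod_cast hd
    rcases le_or_gt (1 / (N : ℝ)) E with hNE | hNE
    · obtain ⟨b, hb, h1⟩ := hS.centeredGap_le_of_one_le hlE hNE hlippos hN hδ hδ1 hΛ hhi.le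
        hr1 hrd hσ
      refine (hS.gap_le hl hlE hE.le A hb).trans ?_
      have h2 : Real.sqrt ((r : ℝ) * ((w L : ℝ) + w 0) / N) ≤ 2 * X := by
        rw [Real.sqrt_le_left (by positivity), mul_pow, Real.sq_sqrt (by positivity),
          ← mul_div_assoc]
        refine div_le_div_of_nonneg_right ?_ (by positivity)
        have : (r : ℝ) * ((w L : ℝ) + w 0) ≤ 2 * G * ((w L : ℝ) + w 0) := by gcongr
        have : 0 ≤ G * ((w L : ℝ) + w 0) := by positivity
        linarith
      have h3 : 2000 * (E + 1) * Real.log Λ ^ 2 * Real.sqrt ((r : ℝ) * ((w L : ℝ) + w 0) / N) ≤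
          2000 * (E + 1) * Real.log Λ ^ 2 * (2 * X) := by gcongr
      have h4 : 0 ≤ (E + 1) * Real.log Λ ^ 2 * X := by positivity
      linarith
    -- Here E < 1/N, so the trivial bound `E` on the gap is already below the complexity term.
    · have hG1 : 1 ≤ G := one_le_complexity hL hq B hx ha hhi.le
      have h1 : E ≤ X := by
        refine hNE.le.trans (Real.le_sqrt_of_sq_le ?_)
        have : 1 ≤ G * ((w L : ℝ) + w 0) := by nlinarith
        calc (1 / (N : ℝ)) ^ 2 ≤ 1 / N := by
              rw [sq, div_mul_div_comm, one_mul]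
              exact one_div_le_one_div_of_le (by positivity) (by nlinarith)
          _ ≤ _ := by gcongr
      refine (gap_le_range hl hlE A S).trans ?_
      have h2 : 0 ≤ E * X := by positivity
      have h3 := key E (by linarith)
      linarith

end LinNet
/-- `E` bounds the loss, `lip` is its Lipschitz constant with respect to the sup norm (the norm of
`Fin n → ℝ`), `w 0 = d` is the input dimension and `w L` is the number of classes. The constants
`c` and `k` are universal. The probability is bounded through the outer measure of the set of bad
samples. -/
theorem mainTheorem9 :
    ∃ (c : ℝ) (k : ℕ), 0 < c ∧
      ∀ (L : ℕ) (_ : 0 < L) (w : ℕ → ℕ) (q : Fin L → ℝ) (_ : ∀ ℓ, 0 ≤ q ℓ ∧ q ℓ ≤ 1)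
        (Y : Type*) [MeasurableSpace Y]
        (D : Measure (EuclideanSpace ℝ (Fin (w 0)) × Y)) [IsProbabilityMeasure D]
        (l : (Fin (w L) → ℝ) → Y → ℝ) (E lip : ℝ)
        (_ : Measurable (Function.uncurry l))
        (_ : ∀ u y, 0 ≤ l u y ∧ l u y ≤ E)
        (_ : 0 ≤ lip) (_ : ∀ u v y, |l u y - l v y| ≤ lip * ‖u - v‖)
        (N : ℕ) (_ : 0 < N) (δ : ℝ) (_ : 0 < δ) (_ : δ < 1),
        Measure.pi (fun _ : Fin N => D)
          {S | ¬ ∀ B : LinNet.Factors L w,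
            LinNet.gap D l (LinNet.netMatrix B) S ≤
              c * E * Real.sqrt (Real.log (4 / δ) / N)
              + c * (E + 1)
                * Real.log (2 + N + w L + w 0 + lip + LinNet.maxInput S
                    + LinNet.specNorm (LinNet.netMatrix B)) ^ k
                * Real.sqrt
                    ((lip * LinNet.maxInput S)
                        ^ (2 * LinNet.conjIndex q / (2 + LinNet.conjIndex q))
                      * LinNet.factorSum q B ^ (2 / (2 + LinNet.conjIndex q))
                      * ((w L : ℝ) + w 0) / N)}
          ≤ ENNReal.ofReal δ := by
  refine ⟨10000, 2, by norm_num, ?_⟩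
  intro L hL w q hq Y _ D _ l E lip hl hlE hlip0 hlip N hN δ hδ hδ1
  obtain ⟨hJ, -⟩ := LinNet.exists_cover_depth (Λ := N + 2) hN le_rfl
  have hE0 : 0 ≤ E := by
    obtain ⟨z⟩ : Nonempty (EuclideanSpace ℝ (Fin (w 0)) × Y) := nonempty_of_isProbabilityMeasure D
    exact (hlE 0 z.2).1.trans (hlE 0 z.2).2
  rcases hE0.eq_or_lt with rfl | hE
  -- For E = 0 the gap is at most 0 and no sample is bad.
  · refine le_trans (le_of_eq ?_) (zero_le)
    convert measure_empty (μ := Measure.pi (fun _ : Fin N => D))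
    rw [Set.eq_empty_iff_forall_notMem]
    intro S hS
    refine hS fun B => (LinNet.gap_le_range hl hlE _ S).trans ?_
    rw [mul_zero, zero_mul, zero_add]
    exact mul_nonneg (mul_nonneg (by norm_num) (sq_nonneg _)) (Real.sqrt_nonneg _)
  · refine le_trans (measure_mono ?_) (LinNet.measure_not_isGoodSample_le D hl hE hlE hlip hN hδ
      hδ1 hJ)
    intro S hS hgood
    exact hS fun B => hgood.gap_netMatrix_le hL hq hl hlE hE hlip0 hlip hN hδ hδ1 B rfl
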